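/- Let $\Lambda=(0,\infty)$, $\beta>0$, $\gamma,\mu\ge 0$, $\eta\in\mathbb R$, and let $f$ be a bounded linear functional on $H^1(\Lambda)$, written $v\mapsto (f,v)$. For $u,v\in H^1(\Lambda)$ (continuous representatives on $[0,\infty)$) put $$A_{\gamma,\mu}(u,v)=\mu u(0)v(0)+\int_0^\infty u'v'\,dx+\gamma\int_0^\infty uv\,dx .$$ A function $u\in H^1(\Lambda)$ is a (weak) solution of the Robin problem $-u''+\gamma u=f$ in $\Lambda$, $-u'(0)+\mu u(0)=\eta$, $\lim_{x\to\infty}u(x)=0$, if $$A_{\gamma,\mu}(u,v)=(f,v)+\eta v(0)\qquad\text{for all } v\in H^1(\Lambda).$$ Let $X_N^\beta=\{e^{-\beta x/2}p(x): p \text{ a real polynomial},\ \deg p\le N\}$. A discrete solution is $u_N\in X_N^\beta$ with $A_{\gamma,\mu}(u_N,v)=(f,v)+\eta v(0)$ for all $v\in X_N^\beta$. Let $l_k^{-1,\beta}(x)=e^{-\beta x/2}\mathcal L_k^{-1}(\beta x)$, where $\mathcal L_k^{\alpha}(x)=\sum_{\nu=0}^k\frac{(\alpha+\nu+1)_{k-\nu}}{(k-\nu)!\,\nu!}(-x)^\nu$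 and $(a)_n=a(a+1)\cdots(a+n-1)$. Define $$\rho_0=\mu+\tfrac{\beta}{4}+\tfrac{\gamma}{\beta},\qquad d_{k-1}=\frac{\beta}{4\rho_{k-1}}-\frac{\gamma}{\beta\rho_{k-1}},\qquad \rho_k=-d_{k-1}^2\rho_{k-1}+\tfrac{\beta}{2}+\tfrac{2\gamma}{\beta}\quad(k\ge1),$$ $$\mathcal R_0^\beta=l_0^{-1,\beta},\qquad \mathcal R_k^\beta=l_k^{-1,\beta}-d_{k-1}\mathcal R_{k-1}^\beta\quad(k\ge1),\qquad \hat u_k=\frac{1}{\rho_k}\left[(f,\mathcal R_k^\beta)+\eta\,\mathcal R_k^\beta(0)\right]\quad(k\ge 0).$$ **Theorem 3.1.** 1. The $\mathcal R_k^\beta$ are the Sobolev orthogonal Laguerre functions: $\mathcal R_k^\beta-l_k^{-1,\beta}\in X_{k-1}^\beta$ (with $X_{-1}^\beta=\{0\}$), $\rho_k>0$, $A_{\gamma,\mu}(\mathcal R_k^\beta,\mathcal R_m^\beta)=\rho_k\delta_{k,m}$ for all $k,m\ge0$, and $X_N^\beta=\operatorname{span}\{\mathcal R_0^\beta,\dots,\mathcal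 R_N^\beta\}$ for every $N\ge 0$. 2. If $u\in H^1(\Lambda)$ is a solution of the Robin problem, then $\hat u_k=\frac1{\rho_k}A_{\gamma,\mu}(u,\mathcal R_k^\beta)$ for all $k\ge 0$, and $u=\sum_{k=0}^\infty\hat u_k\mathcal R_k^\beta$. The series converges to $u$ at every point $x\in[0,\infty)$ and in the energy norm, that is, $A_{\gamma,\mu}(u-S_N,u-S_N)\to0$ for $S_N=\sum_{k=0}^N\hat u_k\mathcal R_k^\beta$; if $\gamma>0$, it also converges in $H^1(\Lambda)$. 3. For every $N\ge0$ the discrete problem has exactly one solution, namely the truncated series $u_N=\sum_{k=0}^N\hat u_k\mathcal R_k^\beta$. 4. The discrete system is diagonal: for real $c_0,\dots,c_N$ one has $A_{\gamma,\mu}\big(\sum_{k=0}^N c_k\mathcal R_k^\beta,\mathcal R_m^\beta\big)=\rho_m c_m$ for $0\le m\le N$, and $\sum_{k=0}^N c_k\mathcal R_k^\beta$ is the discrete solution if and only if $\rho_m c_m=(f,\mathcal R_m^\beta)+\eta\,\mathcal R_m^\beta(0)$ for $0\le m\le N$. -/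

import Mathlib

open MeasureTheory Set Filter Topology Polynomial
open scoped ContDiff

noncomputable section

namespace HalfLine

/-- Lebesgue measure on the half line `Λ = (0, ∞)`. -/
abbrev vol : Measure ℝ := volume.restrict (Ioi (0 : ℝ))

/-- The `L²(Λ)` inner product `(u, v) = ∫_Λ u v dx`. -/
def ip (u v : ℝ → ℝ) : ℝ := ∫ x, u x * v x ∂vol

/-- Test functions `φ ∈ C_c^∞(Λ)`. -/
def IsTest (φ : ℝ → ℝ) : Prop :=
  ContDiff ℝ ∞ φ ∧ HasCompactSupport φ ∧ tsupport φ ⊆ Ioi (0 : ℝ)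

/-- `g` is a square integrable weak derivative of `u` on `Λ`. -/
def IsWeakDeriv (u g : ℝ → ℝ) : Prop :=
  MemLp g 2 vol ∧ ∀ φ : ℝ → ℝ, IsTest φ → ∫ x, u x * deriv φ x ∂vol = -∫ x, g x * φ x ∂vol

/-- Membership in `H¹(Λ)`: the function and its weak derivative are square integrable on `Λ`.
A member is given by its representative that is continuous on `[0, ∞)`, which exists and is unique,
so that its boundary value `u 0` makes sense. Values at negative points play no role. -/
def MemH1 (u : ℝ → ℝ) : Prop :=
  ContinuousOn u (Ici 0) ∧ MemLp u 2 vol ∧ ∃ g, IsWeakDeriv u g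

open Classical in
/-- The weak derivative `u'` (unique almost everywhere on `Λ`); `0` if there is none. -/
def weakDeriv (u : ℝ → ℝ) : ℝ → ℝ :=
  if h : ∃ g, IsWeakDeriv u g then h.choose else 0

lemma IsTest.memLp {φ : ℝ → ℝ} (h : IsTest φ) : MemLp φ 2 vol :=
  (h.1.continuous.memLp_of_hasCompactSupport (μ := volume) h.2.1).restrict _

lemma IsTest.memLp_deriv {φ : ℝ → ℝ} (h : IsTest φ) : MemLp (deriv φ) 2 vol :=
  ((h.1.continuous_deriv (by simp)).memLp_of_hasCompactSupport (μ := volume)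
    h.2.1.deriv).restrict _

lemma IsWeakDeriv.add {u v g h : ℝ → ℝ} (hu : MemLp u 2 vol) (hv : MemLp v 2 vol)
    (hg : IsWeakDeriv u g) (hh : IsWeakDeriv v h) : IsWeakDeriv (u + v) (g + h) := by
  refine ⟨hg.1.add hh.1, fun φ hφ => ?_⟩
  simp only [Pi.add_apply, add_mul]
  have e1 : ∫ x, (u x * deriv φ x + v x * deriv φ x) ∂vol = _ :=
    integral_add (hu.integrable_mul hφ.memLp_deriv) (hv.integrable_mul hφ.memLp_deriv)
  have e2 : ∫ x, (g x * φ x + h x * φ x) ∂vol = _ :=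
    integral_add (hg.1.integrable_mul hφ.memLp) (hh.1.integrable_mul hφ.memLp)
  rw [e1, e2]
  rw [hg.2 φ hφ, hh.2 φ hφ]
  ring

lemma IsWeakDeriv.smul {u g : ℝ → ℝ} (c : ℝ) (hg : IsWeakDeriv u g) :
    IsWeakDeriv (c • u) (c • g) := by
  refine ⟨hg.1.const_smul c, fun φ hφ => ?_⟩
  simp only [Pi.smul_apply, smul_eq_mul, mul_assoc]
  rw [integral_const_mul, integral_const_mul, hg.2 φ hφ]
  ring

lemma isWeakDeriv_zero : IsWeakDeriv 0 0 := ⟨MemLp.zero, fun φ _ => by simp⟩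

/-- The space `H¹(Λ)`. -/
def H1 : Submodule ℝ (ℝ → ℝ) where
  carrier := {u | MemH1 u}
  zero_mem' := ⟨continuousOn_const, MemLp.zero, 0, isWeakDeriv_zero⟩
  add_mem' := by
    rintro u v ⟨cu, hu, g, hg⟩ ⟨cv, hv, h, hh⟩
    exact ⟨cu.add cv, hu.add hv, g + h, IsWeakDeriv.add hu hv hg hh⟩
  smul_mem' := by
    rintro c u ⟨cu, hu, g, hg⟩
    exact ⟨cu.const_smul c, hu.const_smul c, c • g, IsWeakDeriv.smul c hg⟩

/-- The norm of `H¹(Λ)`. -/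
def h1norm (u : H1) : ℝ := √(ip u.1 u.1 + ip (weakDeriv u.1) (weakDeriv u.1))

/-- `f ∈ (H¹(Λ))'`: the linear functional `f` is bounded for the `H¹(Λ)` norm. -/
def IsBoundedFunctional (f : H1 →ₗ[ℝ] ℝ) : Prop := ∃ C : ℝ, ∀ v : H1, |f v| ≤ C * h1norm v

/-- `A_{γ,μ}(u, v) = μ u(0) v(0) + (u', v') + γ (u, v)`. -/
def A (γ μ : ℝ) (u v : H1) : ℝ :=
  μ * u.1 0 * v.1 0 + ip (weakDeriv u.1) (weakDeriv v.1) + γ * ip u.1 v.1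

/-- `u ∈ H¹(Λ)` solves the weak form of
`-u'' + γ u = f` on `Λ`, `-u'(0) + μ u(0) = η`, `u(x) → 0` as `x → ∞`. -/
def IsSolution (γ μ η : ℝ) (f : H1 →ₗ[ℝ] ℝ) (u : H1) : Prop :=
  ∀ v : H1, A γ μ u v = f v + η * v.1 0

/-- The generalized Laguerre polynomial `∑_{ν ≤ k} (α + ν + 1)_{k-ν} / ((k-ν)! ν!) (-x)^ν`,
for an arbitrary real index `α`. -/
def laguerre (α : ℝ) (k : ℕ) : ℝ[X] :=
  ∑ ν ∈ Finset.range (k + 1),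
    C ((ascPochhammer ℝ (k - ν)).eval (α + ν + 1) / ((k - ν).factorial * ν.factorial)) * (-X) ^ ν

lemma memLp_exp_mul_poly {β : ℝ} (hβ : 0 < β) (p : ℝ[X]) :
    MemLp (fun x => Real.exp (-(β * x) / 2) * p.eval x) 2 vol := by
  have hc : Continuous fun x : ℝ => Real.exp (-(β * x) / 2) * p.eval x := by fun_prop
  rw [memLp_two_iff_integrable_sq hc.aestronglyMeasurable]
  have key : ∀ q : ℝ[X], Integrable (fun x => Real.exp (-(β * x)) * q.eval x) vol := by
    intro q
    induction q using Polynomial.induction_on' with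
    | add p q hp hq =>
      refine (hp.add hq).congr (Eventually.of_forall fun x => ?_)
      simp [mul_add]
    | monomial n a =>
      have h := integrableOn_rpow_mul_exp_neg_mul_rpow (p := 1) (s := n) (b := β)
        (by have := Nat.cast_nonneg (α := ℝ) n; linarith) one_pos hβ
      refine (h.const_mul a).congr (Eventually.of_forall fun x => ?_)
      simp
      ring
  refine (key (p ^ 2)).congr (Eventually.of_forall fun x => ?_)
  simp only [Polynomial.eval_pow, mul_pow, ← Real.exp_nat_mul]
  congr 2
  push_cast
  ring

lemma hasDerivAt_exp_mul_poly (β : ℝ) (p : ℝ[X]) (x : ℝ) :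
    HasDerivAt (fun x => Real.exp (-(β * x) / 2) * p.eval x)
      (Real.exp (-(β * x) / 2) * (derivative p - C (β / 2) * p).eval x) x := by
  have h1 : HasDerivAt (fun x : ℝ => -(β * x) / 2) (-(β * 1) / 2) x :=
    (((hasDerivAt_id x).const_mul β).neg).div_const 2
  convert! h1.exp.mul (p.hasDerivAt x) using 1
  simp
  ring

lemma integral_vol_eq {F : ℝ → ℝ} (h : ∀ x ≤ 0, F x = 0) : ∫ x, F x ∂vol = ∫ x, F x :=
  setIntegral_eq_integral_of_forall_compl_eq_zero fun x hx => h x (by simpa using hx)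

lemma memH1_exp_mul_poly {β : ℝ} (hβ : 0 < β) (p : ℝ[X]) :
    MemH1 fun x => Real.exp (-(β * x) / 2) * p.eval x := by
  have hc : ∀ q : ℝ[X], Continuous fun x : ℝ => Real.exp (-(β * x) / 2) * q.eval x :=
    fun q => by fun_prop
  refine ⟨(hc p).continuousOn, memLp_exp_mul_poly hβ p, _,
    memLp_exp_mul_poly hβ (derivative p - C (β / 2) * p), fun φ hφ => ?_⟩
  have hsupp : ∀ x ≤ 0, x ∉ tsupport φ := fun x hx hm => not_lt.2 hx (hφ.2.2 hm)
  have hφ0 : ∀ x ≤ 0, φ x = 0 := fun x hx => image_eq_zero_of_notMem_tsupport (hsupp x hx)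
  have hφ1 : ∀ x ≤ 0, deriv φ x = 0 := fun x hx =>
    image_eq_zero_of_notMem_tsupport fun hm => hsupp x hx (tsupport_deriv_subset hm)
  have hdc : Continuous (deriv φ) := hφ.1.continuous_deriv (by simp)
  rw [integral_vol_eq fun x hx => by simp [hφ1 x hx], integral_vol_eq fun x hx => by simp [hφ0 x hx]]
  refine integral_mul_deriv_eq_deriv_mul_of_integrable
    (fun x _ => hasDerivAt_exp_mul_poly β p x)
    (fun x _ => (hφ.1.differentiable (by simp) x).hasDerivAt) ?_ ?_ ?_
  · exact ((hc p).mul hdc).integrable_of_hasCompactSupport hφ.2.1.deriv.mul_left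
  · exact ((hc _).mul hφ.1.continuous).integrable_of_hasCompactSupport hφ.2.1.mul_left
  · exact ((hc p).mul hφ.1.continuous).integrable_of_hasCompactSupport hφ.2.1.mul_left

/-- The generalized Laguerre function `l_k^{α,β}(x) = e^{-βx/2} L_k^α(βx)`, in `H¹(Λ)`. -/
def lag (α : ℝ) {β : ℝ} (hβ : 0 < β) (k : ℕ) : H1 :=
  ⟨fun x => Real.exp (-(β * x) / 2) * (laguerre α k).eval (β * x), by
    have h := memH1_exp_mul_poly hβ ((laguerre α k).comp (C β * X))
    simp only [eval_comp, eval_mul, eval_C, eval_X] at h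
    exact h⟩

/-- `X_N^β = {e^{-βx/2} p(x) : p a real polynomial of degree at most N}`. -/
def Xset (β : ℝ) (N : ℕ) : Set H1 :=
  {v | ∃ p : ℝ[X], p.natDegree ≤ N ∧ ∀ x, v.1 x = Real.exp (-(β * x) / 2) * p.eval x}

/-- `u_N ∈ X_N^β` solves the Laguerre spectral (Galerkin) scheme. -/
def IsDiscreteSolution (β γ μ η : ℝ) (f : H1 →ₗ[ℝ] ℝ) (N : ℕ) (uN : H1) : Prop :=
  uN ∈ Xset β N ∧ ∀ v ∈ Xset β N, A γ μ uN v = f v + η * v.1 0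

/-- `ρ_0 = μ + β/4 + γ/β`, `ρ_k = -d_{k-1}² ρ_{k-1} + β/2 + 2γ/β`
with `d_{k-1} = (β/4 - γ/β) / ρ_{k-1}`. -/
def rho (β γ μ : ℝ) : ℕ → ℝ
  | 0 => μ + β / 4 + γ / β
  | k + 1 => -((β / 4 - γ / β) / rho β γ μ k) ^ 2 * rho β γ μ k + β / 2 + 2 * γ / β

/-- `d_k = β/(4ρ_k) - γ/(βρ_k)`. -/
def dcoef (β γ μ : ℝ) (k : ℕ) : ℝ := β / (4 * rho β γ μ k) - γ / (β * rho β γ μ k)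

/-- The Sobolev orthogonal Laguerre functions
`R_0 = l_0^{-1,β}`, `R_k = l_k^{-1,β} - d_{k-1} R_{k-1}`. -/
def R (γ μ : ℝ) {β : ℝ} (hβ : 0 < β) : ℕ → H1
  | 0 => lag (-1) hβ 0
  | k + 1 => lag (-1) hβ (k + 1) - dcoef β γ μ k • R γ μ hβ k

/-- The coefficients `û_k = [(f, R_k) + η R_k(0)] / ρ_k`. -/
def coef (γ μ η : ℝ) {β : ℝ} (hβ : 0 < β) (f : H1 →ₗ[ℝ] ℝ) (k : ℕ) : ℝ :=
  (f (R γ μ hβ k) + η * (R γ μ hβ k).1 0) / rho β γ μ k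

/-- The truncated series `∑_{k ≤ N} û_k R_k`. -/
def partialSum (γ μ η : ℝ) {β : ℝ} (hβ : 0 < β) (f : H1 →ₗ[ℝ] ℝ) (N : ℕ) : H1 :=
  ∑ k ∈ Finset.range (N + 1), coef γ μ η hβ f k • R γ μ hβ k

end HalfLine

end

/-! With l_k the L²-orthogonal Laguerre functions of index 0 (norm² 1/β), l_k^{-1} = l_k - l_{k-1}
and its derivative is -(β/2)(l_k + l_{k-1}) for k ≥ 1, and only l_0^{-1} is nonzero at 0. So A is
tridiagonal on the l_k^{-1}, and Gram–Schmidt collapses to the two-term recursion for R_k with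
pivots ρ_k (`A_R_self_and_lt`). The pivots stay above β/4 + γ/β (`le_rho`). As each R_k has exact
degree k, the Galerkin system becomes diagonal.

A solution u satisfies A(u, R_k) = (f, R_k) + η R_k(0), so the partial sums are the A-orthogonal
projections of u onto X_N and hence best approximations. Energy convergence then needs only density
(`exists_poly_A_sub_lt`). Since (d/dx + β/2)(e^{-βx/2} p) = e^{-βx/2} p', one approximates u' +
(β/2)u in L² and fixes p(0) = u(0). For an error e with e(0) = 0, ‖e' + (β/2)e‖² = ‖e'‖² +
(β/2)²‖e‖², which controls the energy. Density in L² is a moment problem (`measure_ext_of_moments`).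

The energy controls e', so pointwise convergence amounts to e(0) → 0. This is immediate if μ > 0 and
a trace inequality if γ > 0. If γ = μ = 0, integrating e against R_{N+1} by parts isolates e(0),
because |R_{N+1}(0)| = 1; orthogonality turns the rest into pairings with R'_{N+1}, which tends
weakly to 0 (`tendsto_sub_truncation_apply_zero`). -/

noncomputable section

namespace HalfLine

/-! ### Density of weighted polynomials in L²(Λ), through the moment problem -/

section Completeness

open ProbabilityTheory

/-- A finite measure on `ℝ` with exponential moments near `0` is determined by its moments. -/
lemma measure_ext_of_moments {μ ν : Measure ℝ} [IsFiniteMeasure μ] [IsFiniteMeasure ν]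
    (hμ : 0 ∈ interior (integrableExpSet id μ)) (hν : 0 ∈ interior (integrableExpSet id ν))
    (h : ∀ n : ℕ, ∫ x, x ^ n ∂μ = ∫ x, x ^ n ∂ν) : μ = ν := by
  set s := interior (integrableExpSet id μ) ∩ interior (integrableExpSet id ν) with hs
  have hsc : Convex ℝ s := convex_integrableExpSet.interior.inter convex_integrableExpSet.interior
  have hF : AnalyticOnNhd ℂ (complexMGF id μ) {z | z.re ∈ s} :=
    analyticOnNhd_complexMGF.mono fun z hz => hz.1
  have hG : AnalyticOnNhd ℂ (complexMGF id ν) {z | z.re ∈ s} :=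
    analyticOnNhd_complexMGF.mono fun z hz => hz.2
  have h0 : (0 : ℂ) ∈ {z : ℂ | z.re ∈ s} := by simp [hs, hμ, hν]
  -- Derivatives at 0 of the complex moment generating function are the moments, so the two Taylor
  -- series at 0 agree.
  have hd : ∀ n, iteratedDeriv n (complexMGF id μ) 0 = iteratedDeriv n (complexMGF id ν) 0 := by
    intro n
    rw [iteratedDeriv_complexMGF (by simpa using hμ), iteratedDeriv_complexMGF (by simpa using hν)]
    have := h n
    simp only [id, zero_mul, Complex.exp_zero, mul_one, ← Complex.ofReal_pow]
    rw [integral_complex_ofReal, integral_complex_ofReal, this]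
  have hloc : complexMGF id μ =ᶠ[𝓝 0] complexMGF id ν := by
    have h1 := (hF 0 h0).hasFPowerSeriesAt
    have h2 := (hG 0 h0).hasFPowerSeriesAt
    simp only [hd] at h1
    obtain ⟨r1, h1⟩ := h1
    obtain ⟨r2, h2⟩ := h2
    have e := (h1.mono (lt_min h1.r_pos h2.r_pos) (min_le_left _ _)).unique
      (h2.mono (lt_min h1.r_pos h2.r_pos) (min_le_right _ _))
    exact e.eventuallyEq_of_mem (Metric.eball_mem_nhds _ (lt_min h1.r_pos h2.r_pos))
  -- Identity theorem on a vertical strip; it contains the imaginary axis, where the values are the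
  -- characteristic functions.
  have heq := hF.eqOn_of_preconnected_of_eventuallyEq hG
    (hsc.linear_preimage Complex.reLm).isPreconnected h0 hloc
  refine Measure.ext_of_charFun (funext fun t => ?_)
  rw [← complexMGF_id_mul_I, ← complexMGF_id_mul_I]
  exact heq (by simp [hs, hμ, hν])

lemma memLp_exp_mul {a : ℝ} (ha : 0 < a) : MemLp (fun x => Real.exp (-(a * x))) 2 vol := by
  have := memLp_exp_mul_poly (β := 2 * a) (by positivity) 1
  refine this.congr_norm (by fun_prop) (Eventually.of_forall fun x => ?_)
  simp
  ring

/-- For |t| < a, the function ρ e^{-(a-t)x} is a product of two L² functions, hence integrable.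
`ENNReal.ofReal` keeps only the positive part of the density. -/
lemma zero_mem_interior_integrableExpSet {ρ : ℝ → ℝ} {a : ℝ} (ha : 0 < a) (hρm : Measurable ρ)
    (hρ : MemLp ρ 2 vol) :
    0 ∈ interior (integrableExpSet id
      (vol.withDensity fun x => ENNReal.ofReal (ρ x * Real.exp (-(a * x))))) := by
  rw [mem_interior]
  refine ⟨Ioo (-a) a, fun t ht => ?_, isOpen_Ioo, by simp [ha]⟩
  change Integrable _ _
  rw [integrable_withDensity_iff_integrable_smul' (by fun_prop) (by simp)]
  have hi := (hρ.integrable_mul (memLp_exp_mul (a := a - t) (by linarith [ht.2])))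
  refine hi.mono (by fun_prop) (Eventually.of_forall fun x => ?_)
  simp only [id, smul_eq_mul, norm_mul, Pi.mul_apply, Real.norm_eq_abs, ENNReal.toReal_ofReal',
    Real.abs_exp]
  have h1 : |max (ρ x * Real.exp (-(a * x))) 0| ≤ |ρ x| * Real.exp (-(a * x)) := by
    rw [abs_of_nonneg (le_max_right _ _)]
    refine max_le ?_ (by positivity)
    gcongr
    exact le_abs_self _
  calc _ ≤ |ρ x| * Real.exp (-(a * x)) * Real.exp (t * x) := by gcongr
    _ = _ := by rw [mul_assoc, ← Real.exp_add]; ring_nf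

/-- The positive and negative parts of g e^{-ax} are densities of finite measures with equal
moments. The measures therefore coincide, and the difference of the parts is 0. -/
lemma ae_eq_zero_of_forall_moment {g : ℝ → ℝ} {a : ℝ} (ha : 0 < a) (hgm : Measurable g)
    (hg : MemLp g 2 vol) (h : ∀ n : ℕ, ∫ x, g x * (Real.exp (-(a * x)) * x ^ n) ∂vol = 0) :
    g =ᵐ[vol] 0 := by
  have hgn : Measurable fun x => -g x := hgm.neg
  have hg2 : MemLp (fun x => -g x) 2 vol := hg.neg
  set w : ℝ → ℝ := fun x => g x * Real.exp (-(a * x)) with hw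
  set w' : ℝ → ℝ := fun x => -g x * Real.exp (-(a * x)) with hw'
  have hwm : Measurable w := by fun_prop
  have hwm' : Measurable w' := by fun_prop
  have hint : ∀ n : ℕ, Integrable (fun x => w x * x ^ n) vol := by
    intro n
    have := hg.integrable_mul (memLp_exp_mul_poly (β := 2 * a) (by positivity) (X ^ n))
    refine this.congr (Eventually.of_forall fun x => ?_)
    simp [hw]
    ring_nf
  have hwi : Integrable w vol := by simpa using hint 0
  have hwi' : Integrable w' vol := by
    refine hwi.neg.congr (Eventually.of_forall fun x => ?_)
    simp [hw, hw']
  have hfin : IsFiniteMeasure (vol.withDensity fun x => ENNReal.ofReal (w x)) :=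
    isFiniteMeasure_withDensity_ofReal hwi.2
  have hfin' : IsFiniteMeasure (vol.withDensity fun x => ENNReal.ofReal (w' x)) :=
    isFiniteMeasure_withDensity_ofReal hwi'.2
  have key : (vol.withDensity fun x => ENNReal.ofReal (w x)) =
      vol.withDensity fun x => ENNReal.ofReal (w' x) := by
    refine measure_ext_of_moments (zero_mem_interior_integrableExpSet ha hgm hg)
      (zero_mem_interior_integrableExpSet ha hgn hg2) fun n => ?_
    rw [integral_withDensity_eq_integral_toReal_smul (by fun_prop) (by simp),
      integral_withDensity_eq_integral_toReal_smul (by fun_prop) (by simp), ← sub_eq_zero]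
    simp only [ENNReal.toReal_ofReal', smul_eq_mul]
    have i1 : Integrable (fun x => max (w x) 0 * x ^ n) vol := by
      refine (hint n).mono (by fun_prop) (Eventually.of_forall fun x => ?_)
      simp only [norm_mul, Real.norm_eq_abs]
      refine mul_le_mul_of_nonneg_right ?_ (abs_nonneg _)
      rw [abs_of_nonneg (le_max_right _ _)]
      exact max_le (le_abs_self _) (abs_nonneg _)
    have i2 : Integrable (fun x => max (w' x) 0 * x ^ n) vol := by
      refine (hint n).mono (by fun_prop) (Eventually.of_forall fun x => ?_)
      simp only [norm_mul, Real.norm_eq_abs]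
      refine mul_le_mul_of_nonneg_right ?_ (abs_nonneg _)
      rw [abs_of_nonneg (le_max_right _ _)]
      refine max_le ?_ (abs_nonneg _)
      simpa [hw, hw'] using neg_le_abs (w x)
    rw [← integral_sub i1 i2]
    refine Eq.trans ?_ (h n)
    refine integral_congr_ae (Eventually.of_forall fun x => ?_)
    change max (w x) 0 * x ^ n - max (w' x) 0 * x ^ n = _
    have : w' x = - w x := by simp [hw, hw']
    rw [← sub_mul, this, max_zero_sub_max_neg_zero_eq_self]
    simp [hw, mul_assoc]
  rw [withDensity_eq_iff (by fun_prop) (by fun_prop)] at key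
  · filter_upwards [key] with x hx
    have h1 : w' x = - w x := by simp [hw, hw']
    have h2 := congrArg ENNReal.toReal hx
    rw [h1, ENNReal.toReal_ofReal', ENNReal.toReal_ofReal'] at h2
    have h3 := max_zero_sub_max_neg_zero_eq_self (w x)
    have : w x = 0 := by linarith
    simpa [hw] using this
  · exact hwi.lintegral_lt_top.ne

/-- `e^{-βx/2} p(x)` as a linear map from polynomials to `L²(Λ)`. -/
def expPolyLp {β : ℝ} (hβ : 0 < β) : ℝ[X] →ₗ[ℝ] Lp ℝ 2 vol where
  toFun p := (memLp_exp_mul_poly hβ p).toLp _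
  map_add' p q := by
    rw [← MemLp.toLp_add]
    congr 1
    funext x
    simp [mul_add]
  map_smul' c p := by
    rw [RingHom.id_apply, ← MemLp.toLp_const_smul]
    congr 1
    funext x
    simp
    ring

lemma expPolyLp_dense {β : ℝ} (hβ : 0 < β) :
    (LinearMap.range (expPolyLp hβ)).topologicalClosure = ⊤ := by
  rw [Submodule.topologicalClosure_eq_top_iff, Submodule.eq_bot_iff]
  intro g hg
  rw [Submodule.mem_orthogonal'] at hg
  have hgm := (Lp.memLp g)
  obtain ⟨g', hg', hgg'⟩ := hgm.1.aemeasurable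
  have h0 : g' =ᵐ[vol] 0 := by
    refine ae_eq_zero_of_forall_moment (a := β / 2) (by positivity) hg'
      (hgm.ae_eq hgg') fun n => ?_
    have := hg (expPolyLp hβ (X ^ n)) ⟨_, rfl⟩
    rw [L2.inner_def] at this
    rw [← this]
    refine integral_congr_ae ?_
    filter_upwards [hgg', (memLp_exp_mul_poly hβ (X ^ n)).coeFn_toLp] with x h1 h2
    have h3 : (expPolyLp hβ (X ^ n) : ℝ → ℝ) x = Real.exp (-(β * x) / 2) * (X ^ n : ℝ[X]).eval x := h2
    rw [h1, h3]
    simp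
    ring_nf
  rw [Lp.eq_zero_iff_ae_eq_zero]
  exact hgg'.trans h0

/-- The functions `e^{-βx/2} p(x)` are dense in `L²(Λ)`. -/
lemma exists_poly_norm_sub_lt {β : ℝ} (hβ : 0 < β) (w : Lp ℝ 2 vol) {ε : ℝ} (hε : 0 < ε) :
    ∃ p : ℝ[X], ‖w - expPolyLp hβ p‖ < ε := by
  have hmem : w ∈ closure (LinearMap.range (expPolyLp hβ) : Set (Lp ℝ 2 vol)) := by
    rw [← Submodule.topologicalClosure_coe, expPolyLp_dense hβ]
    trivial
  obtain ⟨_, ⟨p, rfl⟩, hp⟩ := Metric.mem_closure_iff.1 hmem ε hε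
  exact ⟨p, by rwa [← dist_eq_norm]⟩

end Completeness

/-! ### Calculus in `H¹(Λ)` -/

lemma MemH1.isWeakDeriv {u : ℝ → ℝ} (h : MemH1 u) : IsWeakDeriv u (weakDeriv u) := by
  have := h.2.2
  rw [weakDeriv, dif_pos this]
  exact this.choose_spec

lemma locallyIntegrableOn_of_memLp {g : ℝ → ℝ} (hg : MemLp g 2 vol) :
    LocallyIntegrableOn g (Ioi 0) volume :=
  locallyIntegrableOn_of_locallyIntegrable_restrict (hg.locallyIntegrable (by norm_num))

/-- The fundamental lemma of the calculus of variations, applied to g - h. It lets the chosen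
`weakDeriv` be replaced by any explicit weak derivative. -/
lemma IsWeakDeriv.ae_eq {u g h : ℝ → ℝ} (hg : IsWeakDeriv u g) (hh : IsWeakDeriv u h) :
    g =ᵐ[vol] h := by
  have key := isOpen_Ioi.ae_eq_zero_of_integral_contDiff_smul_eq_zero (U := Ioi (0 : ℝ))
    (f := g - h) (μ := volume) (locallyIntegrableOn_of_memLp (hg.1.sub hh.1)) fun φ h1 h2 h3 => by
      have hφ : IsTest φ := ⟨h1, h2, h3⟩
      have hsupp : ∀ x ≤ 0, φ x = 0 := fun x hx =>
        image_eq_zero_of_notMem_tsupport fun hm => not_lt.2 hx (h3 hm)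
      rw [← integral_vol_eq fun x hx => by simp [hsupp x hx]]
      have e1 := hg.2 φ hφ
      rw [hh.2 φ hφ, neg_inj] at e1
      simp only [Pi.sub_apply, smul_eq_mul, mul_sub]
      refine (integral_sub (hφ.memLp.integrable_mul hg.1) (hφ.memLp.integrable_mul hh.1)).trans ?_
      simp only [Pi.mul_apply]
      simp only [mul_comm (φ _), e1, sub_self]
  rw [EventuallyEq, ae_restrict_iff' measurableSet_Ioi]
  filter_upwards [key] with x hx hx0
  exact sub_eq_zero.1 (hx hx0)

/-- A smooth step of width `1 / (n + 1)` starting at `a`. -/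
def smoothStep (a : ℝ) (n : ℕ) (x : ℝ) : ℝ := Real.smoothTransition ((n + 1) * (x - a))

lemma contDiff_smoothStep (a : ℝ) (n : ℕ) : ContDiff ℝ ∞ (smoothStep a n) :=
  Real.smoothTransition.contDiff.comp (by fun_prop)

lemma smoothStep_of_le {a x : ℝ} (n : ℕ) (h : x ≤ a) : smoothStep a n x = 0 :=
  Real.smoothTransition.zero_of_nonpos (mul_nonpos_of_nonneg_of_nonpos (by positivity) (by linarith))

lemma smoothStep_of_ge {a x : ℝ} (n : ℕ) (h : a + 1 / (n + 1) ≤ x) : smoothStep a n x = 1 := by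
  refine Real.smoothTransition.one_of_one_le ?_
  have : (1 : ℝ) / (n + 1) ≤ x - a := by linarith
  rwa [div_le_iff₀' (by positivity)] at this

lemma tendsto_smoothStep (a x : ℝ) :
    Tendsto (fun n => smoothStep a n x) atTop (𝓝 (if a < x then 1 else 0)) := by
  split_ifs with h
  · refine tendsto_const_nhds.congr' ?_
    have := tendsto_one_div_add_atTop_nhds_zero_nat (𝕜 := ℝ)
    filter_upwards [this.eventually (gt_mem_nhds (sub_pos.2 h))] with n hn
    rw [smoothStep_of_ge n (by linarith)]
  · simp only [smoothStep_of_le _ (not_lt.1 h)]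
    exact tendsto_const_nhds

lemma deriv_smoothStep (a : ℝ) (n : ℕ) (x : ℝ) :
    deriv (smoothStep a n) x = (n + 1) * deriv Real.smoothTransition ((n + 1) * (x - a)) := by
  have h1 : HasDerivAt (fun x : ℝ => (n + 1 : ℝ) * (x - a)) ((n + 1) * 1) x :=
    ((hasDerivAt_id x).sub_const a).const_mul _
  have h2 : HasDerivAt Real.smoothTransition (deriv Real.smoothTransition ((n + 1) * (x - a)))
      ((n + 1) * (x - a)) :=
    ((Real.smoothTransition.contDiff (n := 1)).differentiable (by simp) _).hasDerivAt
  rw [show smoothStep a n = Real.smoothTransition ∘ fun x => (n + 1 : ℝ) * (x - a) from rfl,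
    (h2.comp x h1).deriv]
  ring

lemma deriv_smoothTransition_eq_zero {t : ℝ} (h : t ∉ Icc (0 : ℝ) 1) :
    deriv Real.smoothTransition t = 0 := by
  rw [mem_Icc, not_and_or, not_le, not_le] at h
  rcases h with h | h
  · have : Real.smoothTransition =ᶠ[𝓝 t] fun _ => 0 := by
      filter_upwards [gt_mem_nhds h] with s hs
      exact Real.smoothTransition.zero_of_nonpos hs.le
    rw [this.deriv_eq, deriv_const]
  · have : Real.smoothTransition =ᶠ[𝓝 t] fun _ => 1 := by
      filter_upwards [lt_mem_nhds h] with s hs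
      exact Real.smoothTransition.one_of_one_le hs.le
    rw [this.deriv_eq, deriv_const]

lemma continuous_deriv_smoothTransition : Continuous (deriv Real.smoothTransition) :=
  (Real.smoothTransition.contDiff (n := 1)).continuous_deriv (by simp)

lemma hasCompactSupport_deriv_smoothTransition :
    HasCompactSupport (deriv Real.smoothTransition) :=
  HasCompactSupport.intro isCompact_Icc fun _ h => deriv_smoothTransition_eq_zero h

lemma integral_deriv_smoothTransition : ∫ t, deriv Real.smoothTransition t = 1 := by
  have h : ∫ t in (0 : ℝ)..1, deriv Real.smoothTransition t = 1 := by
    rw [intervalIntegral.integral_deriv_eq_sub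
      (fun x _ => (Real.smoothTransition.contDiff (n := 1)).differentiable (by simp) x)
      (continuous_deriv_smoothTransition.intervalIntegrable _ _)]
    simp
  rw [← h, intervalIntegral.integral_of_le zero_le_one, ← integral_Icc_eq_integral_Ioc,
    setIntegral_eq_integral_of_forall_compl_eq_zero fun x hx => deriv_smoothTransition_eq_zero hx]

/-- The derivatives of the steps form an approximate identity at a: substitute t = (n + 1)(x - a)
and use dominated convergence. -/
lemma tendsto_integral_mul_deriv_smoothStep {v : ℝ → ℝ} (hv : Continuous v) (a : ℝ) :
    Tendsto (fun n => ∫ x, v x * deriv (smoothStep a n) x) atTop (𝓝 (v a)) := by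
  have e : ∀ n : ℕ, ∫ x, v x * deriv (smoothStep a n) x =
      ∫ t, v (a + t / (n + 1)) * deriv Real.smoothTransition t := by
    intro n
    have hn : (0 : ℝ) < n + 1 := by positivity
    have h1 := Measure.integral_comp_mul_left
      (fun t => v (a + t / (n + 1)) * deriv Real.smoothTransition t) ((n : ℝ) + 1)
    have h2 := integral_sub_right_eq_self (μ := volume)
      (fun x : ℝ => v (a + (n + 1) * x / (n + 1)) * deriv Real.smoothTransition ((n + 1) * x)) a
    rw [← h2] at h1
    rw [abs_of_pos (by positivity), smul_eq_mul] at h1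
    have h3 : ∫ t, v (a + t / (n + 1)) * deriv Real.smoothTransition t = (n + 1) *
      ∫ x, v (a + (n + 1) * (x - a) / (n + 1)) * deriv Real.smoothTransition ((n + 1) * (x - a)) := by
      rw [h1]
      field_simp
    rw [h3, ← integral_const_mul]
    congr 1
    funext x
    rw [deriv_smoothStep]
    have : a + (n + 1 : ℝ) * (x - a) / (n + 1) = x := by field_simp; ring
    rw [this]
    ring
  simp only [e]
  obtain ⟨C, hC⟩ := (isCompact_Icc (a := a) (b := a + 1)).exists_bound_of_continuousOn hv.continuousOn
  have hi : Integrable (deriv Real.smoothTransition) :=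
    continuous_deriv_smoothTransition.integrable_of_hasCompactSupport
      hasCompactSupport_deriv_smoothTransition
  have lim : ∫ t, v a * deriv Real.smoothTransition t = v a := by
    rw [integral_const_mul, integral_deriv_smoothTransition, mul_one]
  rw [← lim]
  refine tendsto_integral_of_dominated_convergence
    (fun t => C * ‖deriv Real.smoothTransition t‖) (fun n => ?_) (hi.norm.const_mul C)
    (fun n => Eventually.of_forall fun t => ?_) (Eventually.of_forall fun t => ?_)
  · exact ((hv.comp (by fun_prop)).mul continuous_deriv_smoothTransition).aestronglyMeasurable
  · by_cases ht : t ∈ Icc (0 : ℝ) 1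
    · rw [norm_mul]
      refine mul_le_mul_of_nonneg_right (hC _ ?_) (norm_nonneg _)
      have h1 : 0 ≤ t / (n + 1) := div_nonneg ht.1 (by positivity)
      have h2 : t / (n + 1) ≤ 1 := by
        rw [div_le_one (by positivity)]
        have : (0 : ℝ) ≤ n := n.cast_nonneg
        linarith [ht.2]
      exact ⟨by linarith, by linarith⟩
    · simp [deriv_smoothTransition_eq_zero ht]
  · refine Tendsto.mul_const _ ?_
    have h1 : Tendsto (fun n : ℕ => a + t * (1 / ((n : ℝ) + 1))) atTop (𝓝 (a + t * 0)) :=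
      (tendsto_one_div_add_atTop_nhds_zero_nat.const_mul t).const_add a
    have h2 := (hv.tendsto (a + t * 0)).comp h1
    simp only [mul_zero, add_zero] at h2
    refine h2.congr fun n => ?_
    simp [div_eq_mul_inv]

lemma isTest_smoothStep_sub {a b : ℝ} (ha : 0 < a) (hab : a ≤ b) (n : ℕ) :
    IsTest fun x => smoothStep a n x - smoothStep b n x := by
  have hs : ∀ x ∉ Icc a (b + 1), smoothStep a n x - smoothStep b n x = 0 := by
    intro x hx
    rw [mem_Icc, not_and_or, not_le, not_le] at hx
    rcases hx with h | h
    · rw [smoothStep_of_le n h.le, smoothStep_of_le n (h.le.trans hab), sub_zero]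
    · have : (1 : ℝ) / (n + 1) ≤ 1 := by
        rw [div_le_one (by positivity)]
        have : (0 : ℝ) ≤ n := n.cast_nonneg
        linarith
      rw [smoothStep_of_ge n (by linarith), smoothStep_of_ge n (by linarith), sub_self]
  refine ⟨(contDiff_smoothStep a n).sub (contDiff_smoothStep b n),
    HasCompactSupport.intro isCompact_Icc hs, ?_⟩
  refine (closure_minimal (fun x hx => ?_) isClosed_Icc : _ ⊆ Icc a (b + 1)).trans
    fun x hx => ha.trans_le hx.1
  by_contra hn
  exact hx (hs x hn)

lemma intervalIntegrable_of_memLp {g : ℝ → ℝ} (hg : MemLp g 2 vol) {a b : ℝ} (ha : 0 ≤ a)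
    (hb : 0 ≤ b) : IntervalIntegrable g volume a b := by
  rw [intervalIntegrable_iff]
  have h1 : MemLp g 2 (volume.restrict (uIoc a b)) :=
    hg.mono_measure (Measure.restrict_mono (fun x hx => (le_min ha hb).trans_lt hx.1) le_rfl)
  have : IsFiniteMeasure (volume.restrict (uIoc a b)) := ⟨by simp [uIoc]⟩
  exact h1.integrable (by norm_num)

/-- Test the weak derivative against a smoothed indicator of (a, b]. Its derivative tends to the
difference of point masses at a and b. -/
lemma sub_eq_integral_of_pos {u g : ℝ → ℝ} (hu : ContinuousOn u (Ici 0)) (hg : IsWeakDeriv u g)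
    {a b : ℝ} (ha : 0 < a) (hab : a ≤ b) : u b - u a = ∫ x in a..b, g x := by
  -- A continuous extension to ℝ, since u is only continuous on [0, ∞).
  set v : ℝ → ℝ := fun x => u (max x 0) with hv
  have hvc : Continuous v :=
    hu.comp_continuous (by fun_prop) fun x => mem_Ici.2 (le_max_right _ _)
  have hvu : ∀ x, 0 ≤ x → v x = u x := fun x hx => by simp [hv, hx]
  have hds : ∀ c (n : ℕ), Continuous (deriv (smoothStep c n)) := fun c n =>
    (contDiff_smoothStep c n).continuous_deriv (by simp)
  have hdc : ∀ c (n : ℕ), HasCompactSupport (deriv (smoothStep c n)) := by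
    intro c n
    refine HasCompactSupport.intro (isCompact_Icc (a := c) (b := c + 1)) fun x hx => ?_
    rw [deriv_smoothStep, deriv_smoothTransition_eq_zero, mul_zero]
    contrapose! hx
    have hn : (0 : ℝ) ≤ n := n.cast_nonneg
    have h1 : 0 ≤ x - c := nonneg_of_mul_nonneg_right hx.1 (by positivity)
    have h2 := hx.2
    constructor
    · linarith
    · nlinarith
  have lhs : ∀ n, ∫ x, u x * deriv (fun x => smoothStep a n x - smoothStep b n x) x ∂vol =
      (∫ x, v x * deriv (smoothStep a n) x) - ∫ x, v x * deriv (smoothStep b n) x := by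
    intro n
    have hd : ∀ x, deriv (fun x => smoothStep a n x - smoothStep b n x) x =
        deriv (smoothStep a n) x - deriv (smoothStep b n) x := fun x =>
      deriv_fun_sub ((contDiff_smoothStep a n).differentiable (by simp) x)
        ((contDiff_smoothStep b n).differentiable (by simp) x)
    refine Eq.trans ?_
      (integral_sub ((hvc.mul (hds a n)).integrable_of_hasCompactSupport (hdc a n).mul_left)
      ((hvc.mul (hds b n)).integrable_of_hasCompactSupport (hdc b n).mul_left))
    rw [← integral_vol_eq]
    · refine setIntegral_congr_fun measurableSet_Ioi fun x hx => ?_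
      simp only [hd, hvu x (le_of_lt hx)]
      ring
    · intro x hx
      rw [deriv_smoothStep, deriv_smoothStep, deriv_smoothTransition_eq_zero,
        deriv_smoothTransition_eq_zero]
      · ring
      · intro h
        have := nonneg_of_mul_nonneg_right h.1 (by positivity)
        linarith
      · intro h
        have := nonneg_of_mul_nonneg_right h.1 (by positivity)
        linarith
  have l1 := (tendsto_integral_mul_deriv_smoothStep hvc a).sub
    (tendsto_integral_mul_deriv_smoothStep hvc b)
  simp only [← lhs] at l1
  rw [hvu a ha.le, hvu b (ha.le.trans hab)] at l1
  have l2 : Tendsto (fun n => ∫ x, g x * (smoothStep a n x - smoothStep b n x) ∂vol) atTop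
      (𝓝 (∫ x, (Ioc a b).indicator g x ∂vol)) := by
    have hgi : Integrable ((Icc a (b + 1)).indicator fun x => ‖g x‖) vol := by
      have h1 : IntegrableOn g (Icc a (b + 1)) vol := by
        have := intervalIntegrable_of_memLp hg.1 ha.le (show 0 ≤ b + 1 by linarith)
        rw [intervalIntegrable_iff_integrableOn_Icc_of_le (by linarith)] at this
        exact this.mono_measure Measure.restrict_le_self
      rw [integrable_indicator_iff measurableSet_Icc]
      exact h1.norm
    refine tendsto_integral_of_dominated_convergence _ (fun n => ?_) hgi
      (fun n => Eventually.of_forall fun x => ?_) (Eventually.of_forall fun x => ?_)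
    · exact hg.1.1.mul ((contDiff_smoothStep a n).continuous.sub
        (contDiff_smoothStep b n).continuous).aestronglyMeasurable
    · by_cases hx : x ∈ Icc a (b + 1)
      · rw [indicator_of_mem hx, norm_mul]
        refine mul_le_of_le_one_right (norm_nonneg _) ?_
        rw [Real.norm_eq_abs, abs_le]
        have h1 := Real.smoothTransition.nonneg ((n + 1) * (x - a))
        have h2 := Real.smoothTransition.nonneg ((n + 1) * (x - b))
        have h3 := Real.smoothTransition.le_one ((n + 1) * (x - a))
        have h4 := Real.smoothTransition.le_one ((n + 1) * (x - b))
        simp only [smoothStep]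
        constructor <;> linarith
      · rw [indicator_of_notMem hx]
        rw [mem_Icc, not_and_or, not_le, not_le] at hx
        have : smoothStep a n x - smoothStep b n x = 0 := by
          rcases hx with h | h
          · rw [smoothStep_of_le n h.le, smoothStep_of_le n (h.le.trans hab), sub_zero]
          · have : (1 : ℝ) / (n + 1) ≤ 1 := by
              rw [div_le_one (by positivity)]
              have : (0 : ℝ) ≤ n := n.cast_nonneg
              linarith
            rw [smoothStep_of_ge n (by linarith), smoothStep_of_ge n (by linarith), sub_self]
        simp [this]
    · have := ((tendsto_smoothStep a x).sub (tendsto_smoothStep b x)).const_mul (g x)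
      convert! this using 2
      by_cases h1 : a < x <;> by_cases h2 : b < x
      · simp [h1, h2]
      · simp [h1, h2, not_lt.1 h2]
      · exact absurd (hab.trans_lt h2) h1
      · simp [h1, h2]
  have e2 : ∫ x, (Ioc a b).indicator g x ∂vol = ∫ x in a..b, g x := by
    rw [integral_indicator measurableSet_Ioc, intervalIntegral.integral_of_le hab,
      Measure.restrict_restrict measurableSet_Ioc,
      inter_eq_left.2 fun x (hx : x ∈ Ioc a b) => mem_Ioi.2 (ha.trans hx.1)]
  rw [e2] at l2
  have l3 := l2.neg
  have e3 : ∀ n, -∫ x, g x * (smoothStep a n x - smoothStep b n x) ∂vol =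
      ∫ x, u x * deriv (fun x => smoothStep a n x - smoothStep b n x) x ∂vol := fun n =>
    (hg.2 _ (isTest_smoothStep_sub ha hab n)).symm
  simp only [e3] at l3
  have := tendsto_nhds_unique l1 l3
  linarith

/-- Test functions vanish near 0, so the endpoint 0 is reached by letting a decrease to 0, using
continuity of u there. -/
lemma sub_eq_integral {u g : ℝ → ℝ} (hu : ContinuousOn u (Ici 0)) (hg : IsWeakDeriv u g)
    {b : ℝ} (hb : 0 ≤ b) : u b - u 0 = ∫ x in (0)..b, g x := by
  rcases hb.eq_or_lt with rfl | hb
  · simp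
  have h1 : Tendsto u (𝓝[>] 0) (𝓝 (u 0)) :=
    (hu 0 (by simp)).mono_left (nhdsWithin_mono _ Ioi_subset_Ici_self)
  have h2 : Tendsto (fun a => ∫ x in a..b, g x) (𝓝[>] 0) (𝓝 (∫ x in (0)..b, g x)) := by
    have hi : IntegrableOn g (uIcc 0 b) := by
      have := intervalIntegrable_of_memLp hg.1 le_rfl hb.le
      rw [uIcc_of_le hb.le]
      rwa [intervalIntegrable_iff_integrableOn_Icc_of_le hb.le] at this
    have hc := intervalIntegral.continuousOn_primitive_interval_left (μ := volume) hi
    have := hc 0 (by simp)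
    refine this.mono_left ?_
    rw [← nhdsWithin_Ioo_eq_nhdsGT hb, uIcc_of_le hb.le]
    exact nhdsWithin_mono _ Ioo_subset_Icc_self
  refine tendsto_nhds_unique (tendsto_const_nhds.sub h1) (h2.congr' ?_)
  filter_upwards [Ioo_mem_nhdsGT hb] with a ha
  exact (sub_eq_integral_of_pos hu hg ha.1 ha.2.le).symm

/-- On [0, b] both functions equal primitives of their weak derivatives, which are absolutely
continuous; the product rule for such functions applies. -/
lemma integral_product_rule {u v g h : ℝ → ℝ} (hu : ContinuousOn u (Ici 0))
    (hv : ContinuousOn v (Ici 0)) (hg : IsWeakDeriv u g) (hh : IsWeakDeriv v h) {b : ℝ}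
    (hb : 0 ≤ b) : ∫ x in (0)..b, (g x * v x + u x * h x) = u b * v b - u 0 * v 0 := by
  have ig := intervalIntegrable_of_memLp hg.1 le_rfl hb
  have ih := intervalIntegrable_of_memLp hh.1 le_rfl hb
  have h0 : (0 : ℝ) ∈ uIcc 0 b := left_mem_uIcc
  have key : ∀ {u g : ℝ → ℝ}, ContinuousOn u (Ici 0) → IsWeakDeriv u g →
      IntervalIntegrable g volume 0 b → ∃ U : ℝ → ℝ, AbsolutelyContinuousOnInterval U 0 b ∧
        (∀ x ∈ Icc 0 b, U x = u x) ∧ ∀ᵐ x, x ∈ uIcc 0 b → deriv U x = g x := by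
    intro u g hu hg ig
    refine ⟨fun x => u 0 + ∫ t in (0)..x, g t, ?_, fun x hx => ?_, ?_⟩
    · exact (LipschitzWith.const (u 0)).lipschitzOnWith.absolutelyContinuousOnInterval.add
        (ig.absolutelyContinuousOnInterval_intervalIntegral h0)
    · simp only [← sub_eq_integral hu hg hx.1]
      ring
    · filter_upwards [ig.ae_hasDerivAt_integral] with x hx hxb
      exact ((hx hxb 0 h0).const_add (u 0)).deriv
  obtain ⟨U, aU, eU, dU⟩ := key hu hg ig
  obtain ⟨V, aV, eV, dV⟩ := key hv hh ih
  have := aU.integral_deriv_mul_eq_sub aV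
  rw [eU b ⟨hb, le_rfl⟩, eU 0 ⟨le_rfl, hb⟩, eV b ⟨hb, le_rfl⟩, eV 0 ⟨le_rfl, hb⟩] at this
  rw [← this]
  refine intervalIntegral.integral_congr_ae ?_
  filter_upwards [dU, dV] with x h1 h2 hx
  have hx' : x ∈ uIcc 0 b := uIoc_subset_uIcc hx
  rw [h1 hx', h2 hx']
  rw [uIcc_of_le hb] at hx'
  rw [eU x hx', eV x hx']

/-- The derivative of uv is integrable, so uv has a limit at infinity. As uv is itself integrable,
the limit must be 0. -/
lemma tendsto_mul_atTop_zero {u v : ℝ → ℝ} (hu : MemH1 u) (hv : MemH1 v) :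
    Tendsto (fun x => u x * v x) atTop (𝓝 0) := by
  obtain ⟨cu, mu, g, hg⟩ := hu
  obtain ⟨cv, mv, h, hh⟩ := hv
  have hi : IntegrableOn (fun x => g x * v x + u x * h x) (Ioi 0) :=
    (hg.1.integrable_mul mv).add (mu.integrable_mul hh.1)
  have l1 := (intervalIntegral_tendsto_integral_Ioi 0 hi tendsto_id).const_add (u 0 * v 0)
  set c := u 0 * v 0 + ∫ x in Ioi 0, (g x * v x + u x * h x)
  have l2 : Tendsto (fun x => u x * v x) atTop (𝓝 c) := by
    refine l1.congr' ?_
    filter_upwards [eventually_ge_atTop 0] with b hb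
    simp only [id, integral_product_rule cu cv hg hh hb]
    ring
  have hI : IntegrableAtFilter (fun x => u x * v x) atTop volume :=
    ⟨Ioi 0, Ioi_mem_atTop 0, mu.integrable_mul mv⟩
  have : c = 0 := hI.eq_zero_of_tendsto (fun s hs => by
    obtain ⟨a, ha⟩ := mem_atTop_sets.1 hs
    rw [← top_le_iff, ← Real.volume_Ici (a := a)]
    exact measure_mono ha) l2
  rwa [this] at l2

/-- Integration by parts on the half line. -/
lemma ip_weakDeriv_add {u v g h : ℝ → ℝ} (hu : MemH1 u) (hv : MemH1 v) (hg : IsWeakDeriv u g)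
    (hh : IsWeakDeriv v h) : ip g v + ip u h = -(u 0 * v 0) := by
  have i1 : Integrable (fun x => g x * v x) vol := hg.1.integrable_mul hv.2.1
  have i2 : Integrable (fun x => u x * h x) vol := hu.2.1.integrable_mul hh.1
  have hi : IntegrableOn (fun x => g x * v x + u x * h x) (Ioi 0) := i1.add i2
  have l1 := intervalIntegral_tendsto_integral_Ioi 0 hi tendsto_id
  have l2 := (tendsto_mul_atTop_zero hu hv).sub_const (u 0 * v 0)
  rw [zero_sub] at l2
  have l3 : Tendsto (fun b => ∫ x in (0)..b, (g x * v x + u x * h x)) atTop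
      (𝓝 (-(u 0 * v 0))) := by
    refine l2.congr' ?_
    filter_upwards [eventually_ge_atTop 0] with b hb
    rw [integral_product_rule hu.1 hv.1 hg hh hb]
  rw [← tendsto_nhds_unique l1 l3, ip, ip, ← integral_add i1 i2]

/-! ### `H¹(Λ)` in terms of `L²(Λ)` -/

/-- The inclusion `H¹(Λ) → L²(Λ)`. -/
def toL2 : H1 →ₗ[ℝ] Lp ℝ 2 vol where
  toFun u := u.2.2.1.toLp _
  map_add' u v := (MemLp.toLp_add u.2.2.1 v.2.2.1)
  map_smul' c u := (MemLp.toLp_const_smul c u.2.2.1)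

/-- The weak derivative `H¹(Λ) → L²(Λ)`. -/
def derivL2 : H1 →ₗ[ℝ] Lp ℝ 2 vol where
  toFun u := (MemH1.isWeakDeriv u.2).1.toLp _
  map_add' u v := by
    rw [← MemLp.toLp_add, MemLp.toLp_eq_toLp_iff]
    exact (MemH1.isWeakDeriv (u + v).2).ae_eq
      (IsWeakDeriv.add u.2.2.1 v.2.2.1 (MemH1.isWeakDeriv u.2) (MemH1.isWeakDeriv v.2))
  map_smul' c u := by
    rw [RingHom.id_apply, ← MemLp.toLp_const_smul, MemLp.toLp_eq_toLp_iff]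
    exact (MemH1.isWeakDeriv (c • u).2).ae_eq (IsWeakDeriv.smul c (MemH1.isWeakDeriv u.2))

lemma derivL2_eq (u : H1) {g : ℝ → ℝ} (hg : IsWeakDeriv u.1 g) : derivL2 u = hg.1.toLp g :=
  (MemLp.toLp_eq_toLp_iff (MemH1.isWeakDeriv u.2).1 hg.1).2 ((MemH1.isWeakDeriv u.2).ae_eq hg)

lemma inner_toLp {f g : ℝ → ℝ} (hf : MemLp f 2 vol) (hg : MemLp g 2 vol) :
    inner ℝ (hf.toLp f) (hg.toLp g) = ip f g := by
  rw [L2.inner_def, ip]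
  refine integral_congr_ae ?_
  filter_upwards [hf.coeFn_toLp, hg.coeFn_toLp] with x h1 h2
  rw [h1, h2]
  simp [mul_comm]

lemma A_eq_inner (γ μ : ℝ) (u v : H1) : A γ μ u v =
    μ * u.1 0 * v.1 0 + inner ℝ (derivL2 u) (derivL2 v) + γ * inner ℝ (toL2 u) (toL2 v) := by
  rw [A, ← inner_toLp u.2.2.1 v.2.2.1,
    ← inner_toLp (MemH1.isWeakDeriv u.2).1 (MemH1.isWeakDeriv v.2).1]
  rfl

lemma h1norm_sq (u : H1) : h1norm u ^ 2 = ‖toL2 u‖ ^ 2 + ‖derivL2 u‖ ^ 2 := by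
  rw [h1norm, ← inner_toLp u.2.2.1 u.2.2.1,
    ← inner_toLp (MemH1.isWeakDeriv u.2).1 (MemH1.isWeakDeriv u.2).1, real_inner_self_eq_norm_sq,
    real_inner_self_eq_norm_sq, Real.sq_sqrt (by positivity)]
  rfl

/-- Integration by parts in Hilbert space form. Laguerre orthogonality, the trace bound and the
boundary argument for γ = μ = 0 all rest on it. -/
lemma inner_derivL2_add (u v : H1) :
    inner ℝ (derivL2 u) (toL2 v) + inner ℝ (toL2 u) (derivL2 v) = -(u.1 0 * v.1 0) := by
  rw [← ip_weakDeriv_add u.2 v.2 (MemH1.isWeakDeriv u.2) (MemH1.isWeakDeriv v.2),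
    ← inner_toLp (MemH1.isWeakDeriv u.2).1 v.2.2.1, ← inner_toLp u.2.2.1 (MemH1.isWeakDeriv v.2).1]
  rfl

/-- `A_{γ,μ}` as a bilinear form. -/
def bilinA (γ μ : ℝ) : LinearMap.BilinForm ℝ H1 :=
  LinearMap.mk₂ ℝ (A γ μ)
    (fun u v w => by
      simp only [A_eq_inner, map_add, inner_add_left, Submodule.coe_add, Pi.add_apply]; ring)
    (fun c u v => by
      simp only [A_eq_inner, map_smul, real_inner_smul_left, Submodule.coe_smul, Pi.smul_apply,
        smul_eq_mul]; ring)
    (fun u v w => by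
      simp only [A_eq_inner, map_add, inner_add_right, Submodule.coe_add, Pi.add_apply]; ring)
    (fun c u v => by
      simp only [A_eq_inner, map_smul, real_inner_smul_right, Submodule.coe_smul, Pi.smul_apply,
        smul_eq_mul]; ring)

lemma bilinA_apply (γ μ : ℝ) (u v : H1) : bilinA γ μ u v = A γ μ u v := rfl

lemma A_comm (γ μ : ℝ) (u v : H1) : A γ μ u v = A γ μ v u := by
  simp only [A_eq_inner, real_inner_comm]
  ring

lemma A_nonneg {γ μ : ℝ} (hγ : 0 ≤ γ) (hμ : 0 ≤ μ) (u : H1) : 0 ≤ A γ μ u u := by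
  rw [A_eq_inner, real_inner_self_eq_norm_sq, real_inner_self_eq_norm_sq, mul_assoc]
  have := mul_self_nonneg (u.1 0)
  positivity

lemma A_sub_left (γ μ : ℝ) (u v w : H1) : A γ μ (u - v) w = A γ μ u w - A γ μ v w := by
  simp only [← bilinA_apply, map_sub, LinearMap.sub_apply]

lemma A_sub_right (γ μ : ℝ) (u v w : H1) : A γ μ u (v - w) = A γ μ u v - A γ μ u w := by
  simp only [← bilinA_apply, map_sub]

lemma A_smul_left (γ μ c : ℝ) (u v : H1) : A γ μ (c • u) v = c * A γ μ u v := by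
  simp only [← bilinA_apply, map_smul, LinearMap.smul_apply, smul_eq_mul]

lemma A_smul_right (γ μ c : ℝ) (u v : H1) : A γ μ u (c • v) = c * A γ μ u v := by
  simp only [← bilinA_apply, map_smul, smul_eq_mul]

/-! ### Exponentially weighted polynomials -/

variable {β : ℝ}

/-- The function `e^{-βx/2} p(x)` in `H¹(Λ)`. -/
def expPoly (hβ : 0 < β) : ℝ[X] →ₗ[ℝ] H1 where
  toFun p := ⟨fun x => Real.exp (-(β * x) / 2) * p.eval x, memH1_exp_mul_poly hβ p⟩
  map_add' p q := by
    ext x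
    simp [mul_add]
  map_smul' c p := by
    ext x
    simp
    ring

lemma expPoly_apply (hβ : 0 < β) (p : ℝ[X]) (x : ℝ) :
    (expPoly hβ p).1 x = Real.exp (-(β * x) / 2) * p.eval x := rfl

@[simp] lemma expPoly_zero (hβ : 0 < β) (p : ℝ[X]) : (expPoly hβ p).1 0 = p.eval 0 := by
  simp [expPoly_apply]

lemma toL2_expPoly (hβ : 0 < β) (p : ℝ[X]) : toL2 (expPoly hβ p) = expPolyLp hβ p := rfl

lemma isWeakDeriv_expPoly (hβ : 0 < β) (p : ℝ[X]) :
    IsWeakDeriv (expPoly hβ p).1 fun x =>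
      Real.exp (-(β * x) / 2) * (derivative p - C (β / 2) * p).eval x := by
  have hc : ∀ q : ℝ[X], Continuous fun x : ℝ => Real.exp (-(β * x) / 2) * q.eval x :=
    fun q => by fun_prop
  refine ⟨memLp_exp_mul_poly hβ (derivative p - C (β / 2) * p), fun φ hφ => ?_⟩
  have hsupp : ∀ x ≤ 0, x ∉ tsupport φ := fun x hx hm => not_lt.2 hx (hφ.2.2 hm)
  have hφ0 : ∀ x ≤ 0, φ x = 0 := fun x hx => image_eq_zero_of_notMem_tsupport (hsupp x hx)
  have hφ1 : ∀ x ≤ 0, deriv φ x = 0 := fun x hx =>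
    image_eq_zero_of_notMem_tsupport fun hm => hsupp x hx (tsupport_deriv_subset hm)
  have hdc : Continuous (deriv φ) := hφ.1.continuous_deriv (by simp)
  rw [integral_vol_eq fun x hx => by simp [hφ1 x hx], integral_vol_eq fun x hx => by simp [hφ0 x hx]]
  refine integral_mul_deriv_eq_deriv_mul_of_integrable
    (fun x _ => hasDerivAt_exp_mul_poly β p x)
    (fun x _ => (hφ.1.differentiable (by simp) x).hasDerivAt) ?_ ?_ ?_
  · exact ((hc p).mul hdc).integrable_of_hasCompactSupport hφ.2.1.deriv.mul_left
  · exact ((hc _).mul hφ.1.continuous).integrable_of_hasCompactSupport hφ.2.1.mul_left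
  · exact ((hc p).mul hφ.1.continuous).integrable_of_hasCompactSupport hφ.2.1.mul_left

/-- Equivalently, d/dx + β/2 acts on weighted polynomials as differentiation of the polynomial
factor; the density proof exploits this. -/
lemma derivL2_expPoly (hβ : 0 < β) (p : ℝ[X]) :
    derivL2 (expPoly hβ p) = expPolyLp hβ (derivative p) - (β / 2) • expPolyLp hβ p := by
  rw [derivL2_eq _ (isWeakDeriv_expPoly hβ p), ← map_smul, ← map_sub]
  simp only [smul_eq_C_mul]
  rfl

lemma mem_Xset_iff (hβ : 0 < β) {N : ℕ} {v : H1} :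
    v ∈ Xset β N ↔ ∃ p : ℝ[X], p.natDegree ≤ N ∧ v = expPoly hβ p := by
  constructor
  · rintro ⟨p, hp, h⟩
    exact ⟨p, hp, Subtype.ext (funext h)⟩
  · rintro ⟨p, hp, rfl⟩
    exact ⟨p, hp, fun x => rfl⟩

/-! ### Laguerre polynomials -/

lemma coeff_laguerre (α : ℝ) (k ν : ℕ) : (laguerre α k).coeff ν =
    if ν ≤ k then (ascPochhammer ℝ (k - ν)).eval (α + ν + 1) /
      ((k - ν).factorial * ν.factorial) * (-1) ^ ν else 0 := by
  have h : ∀ (a : ℝ) (n : ℕ), (C a * (-X) ^ n : ℝ[X]) = C (a * (-1) ^ n) * X ^ n := by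
    intro a n
    rw [neg_pow, C_mul, C_pow, C_neg, C_1, mul_assoc]
  simp only [laguerre, h, finsetSum_coeff, coeff_C_mul_X_pow, Finset.sum_ite_eq,
    Finset.mem_range, Nat.lt_succ_iff]

/-- With n = k - ν, the coefficients share the factor (ν + 1)_n, and what remains is ν = (ν + n + 1)
- (n + 1). -/
lemma laguerre_neg_one_succ (k : ℕ) :
    laguerre (-1) (k + 1) = laguerre 0 (k + 1) - laguerre 0 k := by
  ext ν
  rw [coeff_sub, coeff_laguerre, coeff_laguerre, coeff_laguerre]
  rcases lt_trichotomy ν (k + 1) with h | rfl | h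
  · obtain ⟨n, rfl⟩ := Nat.exists_eq_add_of_le (Nat.lt_succ_iff.1 h)
    rw [if_pos (by omega), if_pos (by omega), if_pos (by omega),
      show ν + n + 1 - ν = n + 1 by omega, show ν + n - ν = n by omega, ← sub_mul]
    congr 1
    have e1 : (ascPochhammer ℝ (n + 1)).eval (-1 + (ν : ℝ) + 1) =
        ν * (ascPochhammer ℝ n).eval (ν + 1 : ℝ) := by
      rw [ascPochhammer_succ_left]
      simp
    have e2 : (ascPochhammer ℝ (n + 1)).eval (0 + (ν : ℝ) + 1) =
        (ascPochhammer ℝ n).eval (ν + 1 : ℝ) * (ν + 1 + n) := by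
      rw [ascPochhammer_succ_right]
      simp
    rw [e1, e2, Nat.factorial_succ, zero_add]
    push_cast
    field_simp
    ring
  · simp
  · rw [if_neg (by omega), if_neg (by omega), if_neg (by omega), sub_zero]

lemma derivative_laguerre_neg_one_succ (k : ℕ) :
    derivative (laguerre (-1) (k + 1)) = -laguerre 0 k := by
  ext ν
  rw [coeff_neg, coeff_derivative, coeff_laguerre, coeff_laguerre]
  by_cases h : ν ≤ k
  · rw [if_pos (by omega), if_pos h, Nat.add_sub_add_right, Nat.factorial_succ]
    push_cast
    rw [show (-1 + ((ν : ℝ) + 1) + 1) = 0 + (ν : ℝ) + 1 by ring]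
    field_simp
    ring
  · rw [if_neg (by omega), if_neg h]
    simp

lemma laguerre_zero_right (α : ℝ) : laguerre α 0 = 1 := by simp [laguerre]

lemma eval_zero_laguerre_neg_one_succ (k : ℕ) : (laguerre (-1) (k + 1)).eval 0 = 0 := by
  rw [← coeff_zero_eq_eval_zero, coeff_laguerre, if_pos (by omega)]
  simp [ascPochhammer_succ_left]

lemma natDegree_laguerre_le (α : ℝ) (k : ℕ) : (laguerre α k).natDegree ≤ k := by
  rw [natDegree_le_iff_coeff_eq_zero]
  intro n hn
  rw [coeff_laguerre, if_neg (by omega)]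

lemma coeff_laguerre_self (α : ℝ) (k : ℕ) : (laguerre α k).coeff k ≠ 0 := by
  rw [coeff_laguerre, if_pos le_rfl]
  simp [Nat.factorial_ne_zero]

/-- The scaled Laguerre polynomial `L_k^α(βx)`. -/
def scaledLaguerre (α β : ℝ) (k : ℕ) : ℝ[X] := (laguerre α k).comp (C β * X)

lemma lag_eq (α : ℝ) (hβ : 0 < β) (k : ℕ) : lag α hβ k = expPoly hβ (scaledLaguerre α β k) := by
  refine Subtype.ext (funext fun x => ?_)
  rw [expPoly_apply, scaledLaguerre]
  simp [lag]

lemma scaledLaguerre_zero (α β : ℝ) : scaledLaguerre α β 0 = 1 := by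
  simp [scaledLaguerre, laguerre_zero_right]

lemma scaledLaguerre_neg_one_succ (β : ℝ) (k : ℕ) : scaledLaguerre (-1) β (k + 1) =
    scaledLaguerre 0 β (k + 1) - scaledLaguerre 0 β k := by
  simp [scaledLaguerre, laguerre_neg_one_succ]

lemma derivative_scaledLaguerre_neg_one_succ (β : ℝ) (k : ℕ) :
    derivative (scaledLaguerre (-1) β (k + 1)) = -β • scaledLaguerre 0 β k := by
  simp [scaledLaguerre, derivative_comp, derivative_laguerre_neg_one_succ, smul_eq_C_mul]

lemma eval_zero_scaledLaguerre_neg_one_succ (β : ℝ) (k : ℕ) :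
    (scaledLaguerre (-1) β (k + 1)).eval 0 = 0 := by
  simp [scaledLaguerre, eval_zero_laguerre_neg_one_succ]

lemma degree_scaledLaguerre (α : ℝ) (hβ : 0 < β) (k : ℕ) :
    (scaledLaguerre α β k).degree = k := by
  have h : (laguerre α k).natDegree = k :=
    le_antisymm (natDegree_laguerre_le α k) (le_natDegree_of_ne_zero (coeff_laguerre_self α k))
  have h0 : laguerre α k ≠ 0 := fun h0 => coeff_laguerre_self α k (by rw [h0, coeff_zero])
  have h1 : (scaledLaguerre α β k).natDegree = k := by
    rw [scaledLaguerre, natDegree_comp, h, natDegree_C_mul_X _ hβ.ne', mul_one]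
  rw [degree_eq_natDegree, h1]
  intro hz
  rw [scaledLaguerre, comp_eq_zero_iff] at hz
  rcases hz with hz | hz
  · exact h0 hz
  · have := congrArg natDegree hz.2
    rw [natDegree_C_mul_X _ hβ.ne', natDegree_C] at this
    omega

/-- The Laguerre function `l_k^{0,β}` in `L²(Λ)`. -/
def lagL2 (hβ : 0 < β) (k : ℕ) : Lp ℝ 2 vol := expPolyLp hβ (scaledLaguerre 0 β k)

lemma toL2_lag_zero (hβ : 0 < β) : toL2 (lag (-1) hβ 0) = lagL2 hβ 0 := by
  rw [lag_eq, toL2_expPoly, lagL2, scaledLaguerre_zero, scaledLaguerre_zero]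

lemma toL2_lag_succ (hβ : 0 < β) (k : ℕ) :
    toL2 (lag (-1) hβ (k + 1)) = lagL2 hβ (k + 1) - lagL2 hβ k := by
  rw [lag_eq, toL2_expPoly, scaledLaguerre_neg_one_succ, map_sub]
  rfl

lemma derivL2_lag_zero (hβ : 0 < β) : derivL2 (lag (-1) hβ 0) = -(β / 2) • lagL2 hβ 0 := by
  rw [lag_eq, derivL2_expPoly, lagL2, scaledLaguerre_zero, scaledLaguerre_zero]
  simp

lemma derivL2_lag_succ (hβ : 0 < β) (k : ℕ) :
    derivL2 (lag (-1) hβ (k + 1)) = -(β / 2) • (lagL2 hβ (k + 1) + lagL2 hβ k) := by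
  rw [lag_eq, derivL2_expPoly, derivative_scaledLaguerre_neg_one_succ, map_smul,
    scaledLaguerre_neg_one_succ, map_sub]
  simp only [lagL2]
  module

lemma lag_zero_apply_zero (hβ : 0 < β) : (lag (-1) hβ 0).1 0 = 1 := by
  rw [lag_eq, expPoly_zero, scaledLaguerre_zero, eval_one]

lemma lag_succ_apply_zero (hβ : 0 < β) (k : ℕ) : (lag (-1) hβ (k + 1)).1 0 = 0 := by
  rw [lag_eq, expPoly_zero, eval_zero_scaledLaguerre_neg_one_succ]

/-- No integral is computed. Integration by parts for the index -1 functions, which vanish at 0 for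
positive order, shows that the Gram matrix is invariant under (i, j) ↦ (i + 1, j + 1). The first row
comes from pairing with l_0^{-1}, whose boundary value is 1. -/
lemma inner_lagL2 (hβ : 0 < β) (i j : ℕ) :
    inner ℝ (lagL2 hβ i) (lagL2 hβ j) = if i = j then 1 / β else 0 := by
  have h00 : inner ℝ (lagL2 hβ 0) (lagL2 hβ 0) = 1 / β := by
    have := inner_derivL2_add (lag (-1) hβ 0) (lag (-1) hβ 0)
    rw [toL2_lag_zero, derivL2_lag_zero, lag_zero_apply_zero, real_inner_smul_left,
      real_inner_smul_right] at this
    rw [eq_div_iff hβ.ne']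
    linarith
  have h0 : ∀ j, inner ℝ (lagL2 hβ 0) (lagL2 hβ (j + 1)) = 0 := by
    intro j
    have := inner_derivL2_add (lag (-1) hβ 0) (lag (-1) hβ (j + 1))
    rw [toL2_lag_zero, derivL2_lag_zero, toL2_lag_succ, derivL2_lag_succ, lag_succ_apply_zero,
      real_inner_smul_left, real_inner_smul_right, inner_sub_right, inner_add_right] at this
    have h : β * inner ℝ (lagL2 hβ 0) (lagL2 hβ (j + 1)) = 0 := by linarith
    exact (mul_eq_zero.1 h).resolve_left hβ.ne'
  have hs : ∀ i j, inner ℝ (lagL2 hβ (i + 1)) (lagL2 hβ (j + 1)) =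
      inner ℝ (lagL2 hβ i) (lagL2 hβ j) := by
    intro i j
    have := inner_derivL2_add (lag (-1) hβ (i + 1)) (lag (-1) hβ (j + 1))
    rw [toL2_lag_succ, derivL2_lag_succ, toL2_lag_succ, derivL2_lag_succ, lag_succ_apply_zero,
      real_inner_smul_left, real_inner_smul_right] at this
    simp only [inner_sub_right, inner_add_right, inner_sub_left, inner_add_left] at this
    have h : β * (inner ℝ (lagL2 hβ (i + 1)) (lagL2 hβ (j + 1)) -
      inner ℝ (lagL2 hβ i) (lagL2 hβ j)) = 0 := by linarith
    exact sub_eq_zero.1 ((mul_eq_zero.1 h).resolve_left hβ.ne')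
  induction i generalizing j with
  | zero =>
    cases j with
    | zero => simpa using h00
    | succ j => simpa using h0 j
  | succ i ih =>
    cases j with
    | zero => rw [real_inner_comm]; simpa using h0 i
    | succ j => rw [hs, ih]; simp

/-! ### The Sobolev orthogonal Laguerre functions -/

variable (γ μ : ℝ)

lemma A_lag_zero_zero (hβ : 0 < β) :
    A γ μ (lag (-1) hβ 0) (lag (-1) hβ 0) = μ + β / 4 + γ / β := by
  rw [A_eq_inner, toL2_lag_zero, derivL2_lag_zero, lag_zero_apply_zero]
  simp only [real_inner_smul_left, real_inner_smul_right, inner_lagL2]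
  simp
  field_simp
  ring

lemma A_lag_succ_self (hβ : 0 < β) (k : ℕ) :
    A γ μ (lag (-1) hβ (k + 1)) (lag (-1) hβ (k + 1)) = β / 2 + 2 * γ / β := by
  rw [A_eq_inner, toL2_lag_succ, derivL2_lag_succ, lag_succ_apply_zero]
  simp only [real_inner_smul_left, real_inner_smul_right, inner_sub_right, inner_add_right,
    inner_sub_left, inner_add_left, inner_lagL2]
  simp
  field_simp
  ring

lemma A_lag_lag_succ (hβ : 0 < β) (k : ℕ) :
    A γ μ (lag (-1) hβ k) (lag (-1) hβ (k + 1)) = β / 4 - γ / β := by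
  cases k with
  | zero =>
    rw [A_eq_inner, toL2_lag_succ, derivL2_lag_succ, lag_succ_apply_zero, toL2_lag_zero,
      derivL2_lag_zero]
    simp only [real_inner_smul_left, real_inner_smul_right, inner_sub_right, inner_add_right,
      inner_lagL2]
    simp
    field_simp
    ring
  | succ k =>
    rw [A_eq_inner, toL2_lag_succ, derivL2_lag_succ, lag_succ_apply_zero, toL2_lag_succ,
      derivL2_lag_succ]
    simp only [real_inner_smul_left, real_inner_smul_right, inner_sub_right, inner_add_right,
      inner_sub_left, inner_add_left, inner_lagL2]
    simp [show k ≠ k + 1 + 1 by omega]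
    field_simp
    ring

/-- Function and derivative of l_i^{-1} involve only the index 0 functions of orders i and i - 1, so
orders at least two apart share none of them. -/
lemma A_lag_lag_of_lt (hβ : 0 < β) {i j : ℕ} (h : i < j) :
    A γ μ (lag (-1) hβ i) (lag (-1) hβ (j + 1)) = 0 := by
  cases i with
  | zero =>
    rw [A_eq_inner, toL2_lag_succ, derivL2_lag_succ, lag_succ_apply_zero, toL2_lag_zero,
      derivL2_lag_zero]
    simp only [real_inner_smul_left, real_inner_smul_right, inner_sub_right, inner_add_right,
      inner_lagL2]
    simp [h.ne]
  | succ i =>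
    rw [A_eq_inner, toL2_lag_succ, derivL2_lag_succ, lag_succ_apply_zero, toL2_lag_succ,
      derivL2_lag_succ]
    simp only [real_inner_smul_left, real_inner_smul_right, inner_sub_right, inner_add_right,
      inner_sub_left, inner_add_left, inner_lagL2]
    simp [h.ne, (show i ≠ j by omega), (show i ≠ j + 1 by omega)]

variable {γ μ}

/-- Mere positivity would not propagate. The bound b = β/4 + γ/β does: the diagonal entry is 2b, and
the subtracted term is (β/4 - γ/β)²/ρ_k ≤ b²/b = b. -/
lemma le_rho (hβ : 0 < β) (hγ : 0 ≤ γ) (hμ : 0 ≤ μ) (k : ℕ) : β / 4 + γ / β ≤ rho β γ μ k := by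
  have hg : 0 ≤ γ / β := by positivity
  induction k with
  | zero => rw [rho]; linarith
  | succ k ih =>
    rw [rho]
    have hpos : 0 < rho β γ μ k := lt_of_lt_of_le (by positivity) ih
    have h1 : ((β / 4 - γ / β) / rho β γ μ k) ^ 2 * rho β γ μ k ≤ β / 4 + γ / β := by
      have : ((β / 4 - γ / β) / rho β γ μ k) ^ 2 * rho β γ μ k =
          (β / 4 - γ / β) ^ 2 / rho β γ μ k := by field_simp
      rw [this, div_le_iff₀ hpos]
      calc (β / 4 - γ / β) ^ 2 ≤ (β / 4 + γ / β) * (β / 4 + γ / β) := by nlinarith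
        _ ≤ _ := by gcongr
    have h2 : 2 * γ / β = 2 * (γ / β) := by ring
    linarith

lemma rho_pos (hβ : 0 < β) (hγ : 0 ≤ γ) (hμ : 0 ≤ μ) (k : ℕ) : 0 < rho β γ μ k :=
  lt_of_lt_of_le (by positivity) (le_rho hβ hγ hμ k)

lemma dcoef_mul_rho (hβ : 0 < β) (hγ : 0 ≤ γ) (hμ : 0 ≤ μ) (k : ℕ) :
    dcoef β γ μ k * rho β γ μ k = β / 4 - γ / β := by
  have := (rho_pos hβ hγ hμ k).ne'
  rw [dcoef]
  field_simp

variable (γ μ)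

lemma A_R_lag_of_lt (hβ : 0 < β) {k j : ℕ} (h : k < j) :
    A γ μ (R γ μ hβ k) (lag (-1) hβ (j + 1)) = 0 := by
  induction k with
  | zero => exact A_lag_lag_of_lt γ μ hβ h
  | succ k ih =>
    rw [R, A_sub_left, A_smul_left, A_lag_lag_of_lt γ μ hβ h, ih (by omega)]
    simp

/-- R_k differs from l_k^{-1} by a multiple of R_{k-1}, which is already orthogonal to l_{k+1}^{-1};
the off-diagonal entry is unchanged. -/
lemma A_R_lag_succ (hβ : 0 < β) (k : ℕ) :
    A γ μ (R γ μ hβ k) (lag (-1) hβ (k + 1)) = β / 4 - γ / β := by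
  cases k with
  | zero => exact A_lag_lag_succ γ μ hβ 0
  | succ k =>
    rw [R, A_sub_left, A_smul_left, A_lag_lag_succ, A_R_lag_of_lt γ μ hβ (Nat.lt_succ_self k)]
    simp

variable {γ μ}

/-- Since l_{k+1}^{-1} is orthogonal to R_j for j < k, Gram–Schmidt removes only its R_k component,
with coefficient (β/4 - γ/β)/ρ_k. The remaining squared norm is the next pivot. -/
lemma A_R_self_and_lt (hβ : 0 < β) (hγ : 0 ≤ γ) (hμ : 0 ≤ μ) (k : ℕ) :
    A γ μ (R γ μ hβ k) (R γ μ hβ k) = rho β γ μ k ∧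
      ∀ j < k, A γ μ (R γ μ hβ j) (R γ μ hβ k) = 0 := by
  induction k with
  | zero => exact ⟨A_lag_zero_zero γ μ hβ, fun j hj => by omega⟩
  | succ k ih =>
    have hd := dcoef_mul_rho hβ hγ hμ k
    have e1 := A_R_lag_succ γ μ hβ k
    have e2 := A_comm γ μ (lag (-1) hβ (k + 1)) (R γ μ hβ k)
    have hd' : (β / 4 - γ / β) / rho β γ μ k = dcoef β γ μ k := by
      rw [← hd, mul_div_cancel_right₀ _ (rho_pos hβ hγ hμ k).ne']
    constructor
    · rw [R, rho, A_sub_left, A_sub_right, A_sub_right, A_smul_left, A_smul_left, A_smul_right,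
        A_smul_right, A_lag_succ_self, e2, e1, ih.1, hd', ← hd]
      ring
    · intro j hj
      rw [R, A_sub_right, A_smul_right]
      rcases Nat.lt_succ_iff_lt_or_eq.1 hj with h | rfl
      · rw [ih.2 j h, A_R_lag_of_lt γ μ hβ h]
        simp
      · rw [e1, ih.1, hd, sub_self]

lemma A_R_R (hβ : 0 < β) (hγ : 0 ≤ γ) (hμ : 0 ≤ μ) (k m : ℕ) :
    A γ μ (R γ μ hβ k) (R γ μ hβ m) = if k = m then rho β γ μ k else 0 := by
  rcases lt_trichotomy k m with h | rfl | h
  · rw [if_neg h.ne, (A_R_self_and_lt hβ hγ hμ m).2 k h]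
  · rw [if_pos rfl, (A_R_self_and_lt hβ hγ hμ k).1]
  · rw [if_neg h.ne', A_comm, (A_R_self_and_lt hβ hγ hμ k).2 m h]

/-- The polynomial factor of `R_k`. -/
def Rpoly (β γ μ : ℝ) : ℕ → ℝ[X]
  | 0 => scaledLaguerre (-1) β 0
  | k + 1 => scaledLaguerre (-1) β (k + 1) - dcoef β γ μ k • Rpoly β γ μ k

lemma R_eq (hβ : 0 < β) (k : ℕ) : R γ μ hβ k = expPoly hβ (Rpoly β γ μ k) := by
  induction k with
  | zero => exact lag_eq _ hβ 0
  | succ k ih => rw [R, Rpoly, map_sub, map_smul, ← ih, lag_eq]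

lemma degree_Rpoly (hβ : 0 < β) (k : ℕ) : (Rpoly β γ μ k).degree = k := by
  induction k with
  | zero => exact degree_scaledLaguerre _ hβ 0
  | succ k ih =>
    rw [Rpoly, degree_sub_eq_left_of_degree_lt, degree_scaledLaguerre _ hβ]
    rw [degree_scaledLaguerre _ hβ]
    refine (degree_smul_le _ _).trans_lt ?_
    rw [ih]
    exact_mod_cast Nat.lt_succ_self k

lemma natDegree_Rpoly (hβ : 0 < β) (k : ℕ) : (Rpoly β γ μ k).natDegree = k :=
  natDegree_eq_of_degree_eq_some (degree_Rpoly hβ k)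

lemma R_sub_lag_mem (hβ : 0 < β) (k : ℕ) :
    R γ μ hβ (k + 1) - lag (-1) hβ (k + 1) ∈ Xset β k := by
  rw [mem_Xset_iff hβ]
  refine ⟨-dcoef β γ μ k • Rpoly β γ μ k, ?_, ?_⟩
  · exact (natDegree_smul_le _ _).trans (natDegree_Rpoly hβ k).le
  · rw [map_smul, ← R_eq, R]
    module

/-- The polynomial factors have exactly one member of each degree, so the first N + 1 span all
polynomials of degree at most N. -/
lemma span_R (hβ : 0 < β) (N : ℕ) :
    (Submodule.span ℝ (R γ μ hβ '' Iic N) : Set H1) = Xset β N := by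
  let S : Polynomial.Sequence ℝ := ⟨Rpoly β γ μ, degree_Rpoly hβ⟩
  have hS := S.span_degreeLE (m := N) fun i _ =>
    (leadingCoeff_ne_zero.2 (S.ne_zero i)).isUnit
  have himg : R γ μ hβ '' Iic N = expPoly hβ '' (S '' Iic N) := by
    rw [image_image]
    exact image_congr fun k _ => R_eq hβ k
  rw [himg, Submodule.span_image, hS]
  ext v
  rw [mem_Xset_iff hβ, SetLike.mem_coe, Submodule.mem_map]
  simp only [mem_degreeLE, natDegree_le_iff_degree_le]
  exact ⟨fun ⟨p, h, e⟩ => ⟨p, h, e.symm⟩, fun ⟨p, h, e⟩ => ⟨p, h, e.symm⟩⟩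

variable {β γ μ : ℝ}

/-! ### Density of the weighted polynomials in the energy norm -/

lemma exists_derivative_eq (q : ℝ[X]) (c : ℝ) : ∃ p : ℝ[X], derivative p = q ∧ p.eval 0 = c := by
  have h : ∃ p : ℝ[X], derivative p = q := by
    induction q using Polynomial.induction_on' with
    | add p q hp hq =>
      obtain ⟨a, rfl⟩ := hp
      obtain ⟨b, rfl⟩ := hq
      exact ⟨a + b, by simp⟩
    | monomial n a =>
      refine ⟨monomial (n + 1) (a / (n + 1)), ?_⟩
      rw [derivative_monomial]
      congr 1
      push_cast
      field_simp
  obtain ⟨p, hp⟩ := h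
  exact ⟨p + C (c - p.eval 0), by simp [hp], by simp⟩

/-- The cross term 2c(u, u') equals -c u(0)², which vanishes. -/
lemma norm_sq_derivL2_add_smul (u : H1) (c : ℝ) (h : u.1 0 = 0) :
    ‖derivL2 u + c • toL2 u‖ ^ 2 = ‖derivL2 u‖ ^ 2 + c ^ 2 * ‖toL2 u‖ ^ 2 := by
  have := inner_derivL2_add u u
  rw [h, real_inner_comm] at this
  rw [norm_add_sq_real, real_inner_smul_right, norm_smul, mul_pow, Real.norm_eq_abs, sq_abs,
    real_inner_comm]
  have h0 : inner ℝ (toL2 u) (derivL2 u) = 0 := by linarith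
  rw [h0]
  ring

lemma exists_poly_A_sub_lt (hβ : 0 < β) (hγ : 0 ≤ γ) (u : H1) {ε : ℝ} (hε : 0 < ε) :
    ∃ p : ℝ[X], A γ μ (u - expPoly hβ p) (u - expPoly hβ p) < ε := by
  -- Chosen so that ‖e'‖² + γ‖e‖² ≤ K(‖e'‖² + (β/2)²‖e‖²).
  set K : ℝ := 1 + γ / (β / 2) ^ 2 with hK
  have hKpos : 0 < K := by positivity
  obtain ⟨q, hq⟩ := exists_poly_norm_sub_lt hβ (derivL2 u + (β / 2) • toL2 u)
    (ε := √(ε / K)) (by positivity)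
  -- The free constant of integration makes the error vanish at 0, which removes both the μ-term and
  -- the cross term.
  obtain ⟨p, rfl, hp0⟩ := exists_derivative_eq q (u.1 0)
  refine ⟨p, ?_⟩
  set e := u - expPoly hβ p with he
  have he0 : e.1 0 = 0 := by
    change u.1 0 - (expPoly hβ p).1 0 = 0
    rw [expPoly_zero, hp0, sub_self]
  have e1 : derivL2 u + (β / 2) • toL2 u - expPolyLp hβ (derivative p) =
      derivL2 e + (β / 2) • toL2 e := by
    rw [he, map_sub, map_sub, derivL2_expPoly, toL2_expPoly]
    module
  have e2 : ‖derivL2 e‖ ^ 2 + (β / 2) ^ 2 * ‖toL2 e‖ ^ 2 < ε / K := by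
    rw [← norm_sq_derivL2_add_smul e _ he0, ← e1, ← Real.sq_sqrt (by positivity : 0 ≤ ε / K)]
    gcongr
  rw [lt_div_iff₀ hKpos] at e2
  refine lt_of_le_of_lt ?_ e2
  rw [A_eq_inner, he0, real_inner_self_eq_norm_sq, real_inner_self_eq_norm_sq, hK]
  have h1 : γ * ‖toL2 e‖ ^ 2 = (β / 2) ^ 2 * ‖toL2 e‖ ^ 2 * (γ / (β / 2) ^ 2) := by
    field_simp
  have h2 : 0 ≤ ‖derivL2 e‖ ^ 2 * (γ / (β / 2) ^ 2) := by positivity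
  have h3 : 0 ≤ (β / 2) ^ 2 * ‖toL2 e‖ ^ 2 := by positivity
  linarith

/-! ### Orthogonal expansions -/

lemma R_mem_Xset (hβ : 0 < β) {k N : ℕ} (h : k ≤ N) : R γ μ hβ k ∈ Xset β N :=
  (mem_Xset_iff hβ).2 ⟨_, (natDegree_Rpoly hβ k).le.trans h, R_eq hβ k⟩

lemma sum_R_mem_Xset (hβ : 0 < β) (N : ℕ) (c : ℕ → ℝ) :
    ∑ k ∈ Finset.range (N + 1), c k • R γ μ hβ k ∈ Xset β N := by
  rw [← span_R (γ := γ) (μ := μ) hβ N, SetLike.mem_coe]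
  refine Submodule.sum_mem _ fun k hk => Submodule.smul_mem _ _ (Submodule.subset_span ⟨k, ?_, rfl⟩)
  exact mem_Iic.2 (Nat.lt_succ_iff.1 (Finset.mem_range.1 hk))

lemma eq_zero_on_Xset (hβ : 0 < β) {N : ℕ} (l : H1 →ₗ[ℝ] ℝ)
    (h : ∀ m ≤ N, l (R γ μ hβ m) = 0) : ∀ v ∈ Xset β N, l v = 0 := by
  intro v hv
  rw [← span_R (γ := γ) (μ := μ) hβ N, SetLike.mem_coe] at hv
  have : Submodule.span ℝ (R γ μ hβ '' Iic N) ≤ LinearMap.ker l := by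
    rw [Submodule.span_le]
    rintro _ ⟨m, hm, rfl⟩
    exact h m hm
  exact this hv

lemma exists_coeff_of_mem_Xset (hβ : 0 < β) {N : ℕ} {v : H1} (hv : v ∈ Xset β N) :
    ∃ c : ℕ → ℝ, v = ∑ k ∈ Finset.range (N + 1), c k • R γ μ hβ k := by
  rw [← span_R (γ := γ) (μ := μ) hβ N, SetLike.mem_coe,
    show Iic N = (Finset.range (N + 1) : Set ℕ) by ext; simp,
    Submodule.mem_span_image_finset_iff_exists_fun'] at hv
  obtain ⟨c, hc⟩ := hv
  exact ⟨c, hc.symm⟩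

lemma A_sum_R (hβ : 0 < β) (hγ : 0 ≤ γ) (hμ : 0 ≤ μ) {N m : ℕ} (hm : m ≤ N) (c : ℕ → ℝ) :
    A γ μ (∑ k ∈ Finset.range (N + 1), c k • R γ μ hβ k) (R γ μ hβ m) = rho β γ μ m * c m := by
  rw [← bilinA_apply, map_sum, LinearMap.sum_apply, Finset.sum_eq_single m]
  · rw [map_smul, LinearMap.smul_apply, bilinA_apply, A_R_R hβ hγ hμ, if_pos rfl, smul_eq_mul,
      mul_comm]
  · intro k _ hk
    rw [map_smul, LinearMap.smul_apply, bilinA_apply, A_R_R hβ hγ hμ, if_neg hk, smul_zero]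
  · intro h
    exact absurd (Finset.mem_range.2 (Nat.lt_succ_iff.2 hm)) h

/-- The truncated expansion of `u` in the Sobolev orthogonal Laguerre functions. -/
def truncation (γ μ : ℝ) (hβ : 0 < β) (u : H1) (N : ℕ) : H1 :=
  ∑ k ∈ Finset.range (N + 1), (A γ μ u (R γ μ hβ k) / rho β γ μ k) • R γ μ hβ k

lemma A_sub_truncation (hβ : 0 < β) (hγ : 0 ≤ γ) (hμ : 0 ≤ μ) (u : H1) (N : ℕ) :
    ∀ v ∈ Xset β N, A γ μ (u - truncation γ μ hβ u N) v = 0 := by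
  refine eq_zero_on_Xset (γ := γ) (μ := μ) hβ (bilinA γ μ (u - truncation γ μ hβ u N)) fun m hm => ?_
  rw [bilinA_apply, A_sub_left, truncation, A_sum_R hβ hγ hμ hm,
    mul_div_cancel₀ _ (rho_pos hβ hγ hμ m).ne', sub_self]

lemma A_R_succ_eq_zero (hβ : 0 < β) (hγ : 0 ≤ γ) (hμ : 0 ≤ μ) (N : ℕ) :
    ∀ v ∈ Xset β N, A γ μ (R γ μ hβ (N + 1)) v = 0 := by
  refine eq_zero_on_Xset (γ := γ) (μ := μ) hβ (bilinA γ μ (R γ μ hβ (N + 1))) fun m hm => ?_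
  rw [bilinA_apply, A_R_R hβ hγ hμ, if_neg (by omega)]

/-- Pythagoras for the semi-definite form A: u - S is orthogonal to S - v ∈ X_N. -/
lemma A_sub_truncation_le (hβ : 0 < β) (hγ : 0 ≤ γ) (hμ : 0 ≤ μ) (u : H1) (N : ℕ) {v : H1}
    (hv : v ∈ Xset β N) :
    A γ μ (u - truncation γ μ hβ u N) (u - truncation γ μ hβ u N) ≤ A γ μ (u - v) (u - v) := by
  set S := truncation γ μ hβ u N with hS
  have h1 : A γ μ (u - S) S = 0 := A_sub_truncation hβ hγ hμ u N S (sum_R_mem_Xset hβ N _)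
  have h2 : A γ μ (u - S) v = 0 := A_sub_truncation hβ hγ hμ u N v hv
  have h3 := A_nonneg hγ hμ (S - v)
  have e : u - v = (u - S) + (S - v) := by abel
  have h4 : A γ μ (u - v) (u - v) = A γ μ (u - S) (u - S) + 2 * A γ μ (u - S) (S - v) +
      A γ μ (S - v) (S - v) := by
    have := A_comm γ μ (S - v) (u - S)
    rw [e]
    simp only [← bilinA_apply, map_add, LinearMap.add_apply] at this ⊢
    rw [this]
    ring
  have h5 : A γ μ (u - S) (S - v) = 0 := by rw [A_sub_right, h1, h2, sub_zero]
  rw [h4, h5]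
  linarith

lemma tendsto_A_sub_truncation (hβ : 0 < β) (hγ : 0 ≤ γ) (hμ : 0 ≤ μ) (u : H1) :
    Tendsto (fun N => A γ μ (u - truncation γ μ hβ u N) (u - truncation γ μ hβ u N)) atTop
      (𝓝 0) := by
  rw [Metric.tendsto_atTop]
  intro ε hε
  obtain ⟨p, hp⟩ := exists_poly_A_sub_lt (μ := μ) hβ hγ u hε
  refine ⟨p.natDegree, fun N hN => ?_⟩
  rw [Real.dist_eq, sub_zero, abs_of_nonneg (A_nonneg hγ hμ _)]
  exact (A_sub_truncation_le hβ hγ hμ u N ((mem_Xset_iff hβ).2 ⟨p, hN, rfl⟩)).trans_lt hp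

/-! ### Pointwise convergence -/

lemma vol_Ioc_ne_top (x : ℝ) : vol (Ioc 0 x) ≠ ⊤ :=
  ((Measure.restrict_apply_le _ _).trans_lt measure_Ioc_lt_top).ne

/-- Beyond the boundary value, evaluation at x is a continuous functional of u' alone, so energy
convergence transfers to points once it holds at 0. -/
lemma apply_eq_add_inner (u : H1) {x : ℝ} (hx : 0 ≤ x) :
    u.1 x = u.1 0 + inner ℝ (indicatorConstLp 2 (measurableSet_Ioc (a := 0) (b := x))
      (vol_Ioc_ne_top x) (1 : ℝ)) (derivL2 u) := by
  rw [L2.inner_indicatorConstLp_one]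
  have h1 := sub_eq_integral u.2.1 (MemH1.isWeakDeriv u.2) hx
  have h2 : ∫ t in Ioc 0 x, derivL2 u t ∂vol = ∫ t in (0)..x, weakDeriv u.1 t := by
    rw [intervalIntegral.integral_of_le hx, Measure.restrict_restrict measurableSet_Ioc,
      inter_eq_left.2 Ioc_subset_Ioi_self]
    have h3 := (MemH1.isWeakDeriv u.2).1.coeFn_toLp
    exact integral_congr_ae (ae_restrict_of_ae_restrict_of_subset Ioc_subset_Ioi_self h3)
  rw [h2, ← h1]
  ring

lemma sq_apply_zero_le (u : H1) : (u.1 0) ^ 2 ≤ 2 * (‖derivL2 u‖ * ‖toL2 u‖) := by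
  have h1 := inner_derivL2_add u u
  rw [real_inner_comm] at h1
  have h2 := neg_le_of_abs_le (abs_real_inner_le_norm (toL2 u) (derivL2 u))
  rw [mul_comm] at h2
  linarith [sq (u.1 0)]

lemma tendsto_norm_derivL2 {e : ℕ → H1} (hγ : 0 ≤ γ) (hμ : 0 ≤ μ)
    (h : Tendsto (fun N => A γ μ (e N) (e N)) atTop (𝓝 0)) :
    Tendsto (fun N => ‖derivL2 (e N)‖) atTop (𝓝 0) := by
  have h1 : Tendsto (fun N => ‖derivL2 (e N)‖ ^ 2) atTop (𝓝 0) := by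
    refine squeeze_zero (fun _ => by positivity) (fun N => ?_) h
    rw [A_eq_inner, real_inner_self_eq_norm_sq, real_inner_self_eq_norm_sq, mul_assoc]
    have := mul_nonneg hμ (mul_self_nonneg ((e N).1 0))
    have : 0 ≤ γ * ‖toL2 (e N)‖ ^ 2 := by positivity
    linarith
  simpa using h1.sqrt

lemma tendsto_norm_toL2 {e : ℕ → H1} (hγ : 0 < γ) (hμ : 0 ≤ μ)
    (h : Tendsto (fun N => A γ μ (e N) (e N)) atTop (𝓝 0)) :
    Tendsto (fun N => ‖toL2 (e N)‖) atTop (𝓝 0) := by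
  have h1 : Tendsto (fun N => ‖toL2 (e N)‖ ^ 2) atTop (𝓝 0) := by
    have h2 := h.div_const γ
    rw [zero_div] at h2
    refine squeeze_zero (fun _ => by positivity) (fun N => ?_) h2
    rw [A_eq_inner, real_inner_self_eq_norm_sq, real_inner_self_eq_norm_sq, mul_assoc,
      le_div_iff₀ hγ]
    have := mul_nonneg hμ (mul_self_nonneg ((e N).1 0))
    have : 0 ≤ ‖derivL2 (e N)‖ ^ 2 := by positivity
    linarith
  simpa using h1.sqrt

lemma tendsto_h1norm {e : ℕ → H1} (h1 : Tendsto (fun N => ‖derivL2 (e N)‖) atTop (𝓝 0))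
    (h2 : Tendsto (fun N => ‖toL2 (e N)‖) atTop (𝓝 0)) :
    Tendsto (fun N => h1norm (e N)) atTop (𝓝 0) := by
  have h3 := ((h2.pow 2).add (h1.pow 2)).sqrt
  simp only [ne_eq, OfNat.ofNat_ne_zero, not_false_eq_true, zero_pow, add_zero, Real.sqrt_zero,
    ← h1norm_sq] at h3
  refine h3.congr fun N => Real.sqrt_sq (Real.sqrt_nonneg _)

/-! The case `γ = μ = 0`, where the energy does not control the boundary value. -/

/-- Here A(w, v) = (w', v'), and v' has polynomial factor q' - (β/2)q. Induction on the degree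
disposes of q', so w' is orthogonal to X_N itself and not only to derivatives. -/
lemma inner_derivL2_expPolyLp_eq_zero (hβ : 0 < β) {w : H1} {N : ℕ}
    (h : ∀ v ∈ Xset β N, A 0 0 w v = 0) (n : ℕ) (hn : n ≤ N) (q : ℝ[X]) (hq : q.natDegree ≤ n) :
    inner ℝ (derivL2 w) (expPolyLp hβ q) = 0 := by
  have key : ∀ q : ℝ[X], q.natDegree ≤ N →
      inner ℝ (derivL2 w) (expPolyLp hβ (derivative q)) = 0 →
      inner ℝ (derivL2 w) (expPolyLp hβ q) = 0 := by
    intro q hq hd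
    have h1 := h (expPoly hβ q) ((mem_Xset_iff hβ).2 ⟨q, hq, rfl⟩)
    rw [A_eq_inner, derivL2_expPoly, inner_sub_right, real_inner_smul_right, hd] at h1
    have h2 : β / 2 * inner ℝ (derivL2 w) (expPolyLp hβ q) = 0 := by linarith
    exact (mul_eq_zero.1 h2).resolve_left (by positivity)
  induction n generalizing q with
  | zero =>
    refine key q (hq.trans hn) ?_
    rw [derivative_of_natDegree_zero (Nat.le_zero.1 hq), map_zero, inner_zero_right]
  | succ n ih =>
    refine key q (hq.trans hn) (ih (by omega) _ ?_)
    exact (natDegree_derivative_le q).trans (by omega)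

lemma rho_zero_zero (hβ : 0 < β) (k : ℕ) : rho β 0 0 k = β / 4 := by
  induction k with
  | zero => simp [rho]
  | succ k ih =>
    rw [rho, ih]
    field_simp
    ring

/-- All ρ_k equal β/4, so every d_k is 1 and the boundary value merely changes sign. -/
lemma R_zero_zero_apply_zero (hβ : 0 < β) (k : ℕ) : (R 0 0 hβ k).1 0 = (-1) ^ k := by
  induction k with
  | zero => rw [R, lag_zero_apply_zero, pow_zero]
  | succ k ih =>
    have hd : dcoef β 0 0 k = 1 := by
      rw [dcoef, rho_zero_zero hβ]
      field_simp
      simp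
    change (lag (-1) hβ (k + 1)).1 0 - dcoef β 0 0 k * (R 0 0 hβ k).1 0 = _
    rw [lag_succ_apply_zero, ih, hd, pow_succ]
    ring

/-- Weak convergence to 0: R'_{N+1} has constant norm √(β/4) and is orthogonal to X_N, and these
spaces exhaust a dense subspace. -/
lemma tendsto_inner_derivL2_R (hβ : 0 < β) (z : Lp ℝ 2 vol) :
    Tendsto (fun N => inner ℝ z (derivL2 (R 0 0 hβ (N + 1)))) atTop (𝓝 0) := by
  have hn : ∀ k, ‖derivL2 (R 0 0 hβ k)‖ = √(β / 4) := by
    intro k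
    have := A_R_R hβ le_rfl le_rfl k k
    rw [A_eq_inner, if_pos rfl, rho_zero_zero hβ, real_inner_self_eq_norm_sq] at this
    rw [← this]
    simp
  have hpos : 0 < √(β / 4) := by positivity
  rw [Metric.tendsto_atTop]
  intro ε hε
  obtain ⟨q, hq⟩ := exists_poly_norm_sub_lt hβ z (ε := ε / √(β / 4)) (by positivity)
  refine ⟨q.natDegree, fun N hN => ?_⟩
  have h0 := inner_derivL2_expPolyLp_eq_zero hβ (A_R_succ_eq_zero hβ le_rfl le_rfl N) N le_rfl q hN
  rw [real_inner_comm] at h0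
  have h1 : inner ℝ z (derivL2 (R 0 0 hβ (N + 1))) =
      inner ℝ (z - expPolyLp hβ q) (derivL2 (R 0 0 hβ (N + 1))) := by
    rw [inner_sub_left, h0, sub_zero]
  rw [Real.dist_eq, sub_zero, h1]
  refine (abs_real_inner_le_norm _ _).trans_lt ?_
  rw [hn]
  exact (lt_div_iff₀ hpos).1 hq

/-- With e = u - S_N and r = R_{N+1}, integration by parts gives |e(0)| = |(e', r) + (e, r')|.
Orthogonality rewrites both terms as pairings of r' with the fixed functions u' and u, which tend to
0. -/
lemma tendsto_sub_truncation_apply_zero (hβ : 0 < β) (u : H1) :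
    Tendsto (fun N => (u - truncation 0 0 hβ u N).1 0) atTop (𝓝 0) := by
  have key : ∀ N, |(u - truncation 0 0 hβ u N).1 0| =
      |-(2 / β) * inner ℝ (derivL2 u) (derivL2 (R 0 0 hβ (N + 1))) +
        inner ℝ (toL2 u) (derivL2 (R 0 0 hβ (N + 1)))| := by
    intro N
    set r := R 0 0 hβ (N + 1) with hr
    set S := truncation 0 0 hβ u N with hS
    obtain ⟨s, hs, hSs⟩ := (mem_Xset_iff hβ).1 (sum_R_mem_Xset (γ := 0) (μ := 0) hβ N
      fun k => A 0 0 u (R 0 0 hβ k) / rho β 0 0 k)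
    replace hSs : S = expPoly hβ s := hSs
    have e1 : inner ℝ (toL2 (u - S)) (derivL2 r) = inner ℝ (toL2 u) (derivL2 r) := by
      rw [map_sub, inner_sub_left, hSs, toL2_expPoly, real_inner_comm _ (expPolyLp hβ s),
        inner_derivL2_expPolyLp_eq_zero hβ (A_R_succ_eq_zero hβ le_rfl le_rfl N) N le_rfl s hs,
        sub_zero]
    have e2 : inner ℝ (derivL2 (u - S)) (derivL2 r) = inner ℝ (derivL2 u) (derivL2 r) := by
      have := A_R_succ_eq_zero hβ le_rfl le_rfl N S (sum_R_mem_Xset hβ N _)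
      rw [A_eq_inner, ← hr, real_inner_comm] at this
      rw [map_sub, inner_sub_left]
      linarith
    have e3 : inner ℝ (derivL2 (u - S)) (toL2 r) =
        -(2 / β) * inner ℝ (derivL2 u) (derivL2 r) := by
      -- The polynomial factor of r has degree N + 1, so its derivative has degree at most N and is
      -- orthogonal to e'. Hence (e', r') = -(β/2)(e', r).
      have h1 := inner_derivL2_expPolyLp_eq_zero hβ (A_sub_truncation hβ le_rfl le_rfl u N) N le_rfl
        (derivative (Rpoly β 0 0 (N + 1)))
        ((natDegree_derivative_le _).trans (by rw [natDegree_Rpoly hβ]; omega))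
      rw [← hS] at h1
      have h2 : inner ℝ (derivL2 (u - S)) (derivL2 r) =
          -(β / 2) * inner ℝ (derivL2 (u - S)) (toL2 r) := by
        rw [hr, R_eq, derivL2_expPoly, inner_sub_right, h1, real_inner_smul_right, toL2_expPoly]
        ring
      rw [← e2, h2]
      field_simp
    have h3 := inner_derivL2_add (u - S) r
    rw [e3, e1] at h3
    rw [h3, abs_neg, abs_mul, hr, R_zero_zero_apply_zero, abs_pow, abs_neg, abs_one, one_pow,
      mul_one]
  rw [tendsto_zero_iff_abs_tendsto_zero]
  simp only [Function.comp_def, key]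
  have := (((tendsto_inner_derivL2_R hβ (derivL2 u)).const_mul (-(2 / β))).add
    (tendsto_inner_derivL2_R hβ (toL2 u))).abs
  simpa using this

lemma tendsto_truncation_apply (hβ : 0 < β) (hγ : 0 ≤ γ) (hμ : 0 ≤ μ) (u : H1) {x : ℝ}
    (hx : 0 ≤ x) : Tendsto (fun N => (truncation γ μ hβ u N).1 x) atTop (𝓝 (u.1 x)) := by
  have hA := tendsto_A_sub_truncation hβ hγ hμ u
  have hd := tendsto_norm_derivL2 hγ hμ hA
  have h0 : Tendsto (fun N => (u - truncation γ μ hβ u N).1 0) atTop (𝓝 0) := by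
    rcases hγ.eq_or_lt with rfl | hγ'
    · rcases hμ.eq_or_lt with rfl | hμ'
      · exact tendsto_sub_truncation_apply_zero hβ u
      · have h1 := (hA.div_const μ).sqrt
        rw [zero_div, Real.sqrt_zero] at h1
        refine squeeze_zero_norm (fun N => ?_) h1
        rw [Real.norm_eq_abs, ← Real.sqrt_sq_eq_abs]
        refine Real.sqrt_le_sqrt ?_
        rw [le_div_iff₀ hμ', A_eq_inner, real_inner_self_eq_norm_sq]
        have : 0 ≤ ‖derivL2 (u - truncation 0 μ hβ u N)‖ ^ 2 := by positivity
        linarith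
    · have h1 := ((hd.mul (tendsto_norm_toL2 hγ' hμ hA)).const_mul 2).sqrt
      rw [mul_zero, mul_zero, Real.sqrt_zero] at h1
      refine squeeze_zero_norm (fun N => ?_) h1
      rw [Real.norm_eq_abs, ← Real.sqrt_sq_eq_abs]
      exact Real.sqrt_le_sqrt (sq_apply_zero_le _)
  have h1 : Tendsto (fun N => (u - truncation γ μ hβ u N).1 x) atTop (𝓝 0) := by
    simp only [apply_eq_add_inner _ hx]
    have h2 := (h0.add (Filter.Tendsto.inner (𝕜 := ℝ)
      (tendsto_const_nhds (x := indicatorConstLp 2 (measurableSet_Ioc (a := 0) (b := x))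
        (vol_Ioc_ne_top x) (1 : ℝ)))
      (tendsto_zero_iff_norm_tendsto_zero.2 hd)))
    simp only [inner_zero_right, add_zero] at h2
    exact h2
  have h2 := h1.const_sub (u.1 x)
  rw [sub_zero] at h2
  refine h2.congr fun N => ?_
  change u.1 x - (u.1 x - (truncation γ μ hβ u N).1 x) = _
  ring

/-! ### The discrete problem -/

lemma isDiscreteSolution_sum_iff (hβ : 0 < β) (hγ : 0 ≤ γ) (hμ : 0 ≤ μ) (η : ℝ)
    (f : H1 →ₗ[ℝ] ℝ) (N : ℕ) (c : ℕ → ℝ) :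
    IsDiscreteSolution β γ μ η f N (∑ k ∈ Finset.range (N + 1), c k • R γ μ hβ k) ↔
      ∀ m ≤ N, rho β γ μ m * c m = f (R γ μ hβ m) + η * (R γ μ hβ m).1 0 := by
  constructor
  · rintro ⟨-, h⟩ m hm
    rw [← A_sum_R hβ hγ hμ hm]
    exact h _ (R_mem_Xset hβ hm)
  · intro h
    refine ⟨sum_R_mem_Xset hβ N c, fun v hv => ?_⟩
    -- Evaluation at 0 as a linear map makes the residual a linear functional, so testing on the R_m
    -- suffices.
    let ev : H1 →ₗ[ℝ] ℝ := (LinearMap.proj (0 : ℝ)).comp H1.subtype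
    have := eq_zero_on_Xset (γ := γ) (μ := μ) hβ
      (bilinA γ μ (∑ k ∈ Finset.range (N + 1), c k • R γ μ hβ k) - (f + η • ev))
      (fun m hm => by
        rw [LinearMap.sub_apply, bilinA_apply, A_sum_R hβ hγ hμ hm, h m hm]
        exact sub_self _) v hv
    exact sub_eq_zero.1 this

lemma isDiscreteSolution_iff (hβ : 0 < β) (hγ : 0 ≤ γ) (hμ : 0 ≤ μ) (η : ℝ)
    (f : H1 →ₗ[ℝ] ℝ) (N : ℕ) (uN : H1) :
    IsDiscreteSolution β γ μ η f N uN ↔ uN = partialSum γ μ η hβ f N := by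
  have hc : ∀ m (c : ℝ), rho β γ μ m * c = f (R γ μ hβ m) + η * (R γ μ hβ m).1 0 ↔
      c = coef γ μ η hβ f m := by
    intro m c
    rw [coef, eq_div_iff (rho_pos hβ hγ hμ m).ne', mul_comm]
  constructor
  · intro h
    obtain ⟨c, rfl⟩ := exists_coeff_of_mem_Xset (γ := γ) (μ := μ) hβ h.1
    rw [isDiscreteSolution_sum_iff hβ hγ hμ] at h
    refine Finset.sum_congr rfl fun m hm => ?_
    rw [(hc m (c m)).1 (h m (Nat.lt_succ_iff.1 (Finset.mem_range.1 hm)))]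
  · rintro rfl
    exact (isDiscreteSolution_sum_iff hβ hγ hμ η f N _).2 fun m _ => (hc m _).2 rfl

end HalfLine

end

theorem theorem3p1 {β : ℝ} (hβ : 0 < β) (γ μ η : ℝ) (hγ : 0 ≤ γ) (hμ : 0 ≤ μ)
    (f : HalfLine.H1 →ₗ[ℝ] ℝ) (hf : HalfLine.IsBoundedFunctional f) :
    -- the basis: `R_k - l_k ∈ X_{k-1}`, orthogonality with `ρ_k > 0`, `X_N = span {R_0, …, R_N}`
    (HalfLine.R γ μ hβ 0 = HalfLine.lag (-1) hβ 0 ∧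
      ∀ k, HalfLine.R γ μ hβ (k + 1) - HalfLine.lag (-1) hβ (k + 1) ∈ HalfLine.Xset β k) ∧
    (∀ k m, HalfLine.A γ μ (HalfLine.R γ μ hβ k) (HalfLine.R γ μ hβ m) =
      if k = m then HalfLine.rho β γ μ k else 0) ∧
    (∀ k, 0 < HalfLine.rho β γ μ k) ∧
    (∀ N, (Submodule.span ℝ (HalfLine.R γ μ hβ '' Set.Iic N) : Set HalfLine.H1) =
      HalfLine.Xset β N) ∧
    -- the exact solution: coefficients, and convergence of the series in the energy norm,
    -- pointwise on `[0, ∞)`, and in `H¹(Λ)` when `γ > 0`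
    (∀ u : HalfLine.H1, HalfLine.IsSolution γ μ η f u →
      (∀ k, HalfLine.coef γ μ η hβ f k =
        HalfLine.A γ μ u (HalfLine.R γ μ hβ k) / HalfLine.rho β γ μ k) ∧
      Tendsto (fun N => HalfLine.A γ μ (u - HalfLine.partialSum γ μ η hβ f N)
        (u - HalfLine.partialSum γ μ η hβ f N)) atTop (𝓝 0) ∧
      (∀ x : ℝ, 0 ≤ x → Tendsto (fun N => ∑ k ∈ Finset.range (N + 1),
        HalfLine.coef γ μ η hβ f k * (HalfLine.R γ μ hβ k).1 x) atTop (𝓝 (u.1 x))) ∧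
      (0 < γ → Tendsto (fun N => HalfLine.h1norm (u - HalfLine.partialSum γ μ η hβ f N))
        atTop (𝓝 0))) ∧
    -- the discrete solution is exactly the truncated series
    (∀ (N : ℕ) (uN : HalfLine.H1), HalfLine.IsDiscreteSolution β γ μ η f N uN ↔
      uN = HalfLine.partialSum γ μ η hβ f N) ∧
    -- the discrete system is diagonal: row `m` involves only the unknown `c m`
    (∀ (N : ℕ) (c : ℕ → ℝ),
      (∀ m ≤ N, HalfLine.A γ μ (∑ k ∈ Finset.range (N + 1), c k • HalfLine.R γ μ hβ k)
        (HalfLine.R γ μ hβ m) = HalfLine.rho β γ μ m * c m) ∧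
      (HalfLine.IsDiscreteSolution β γ μ η f N
          (∑ k ∈ Finset.range (N + 1), c k • HalfLine.R γ μ hβ k) ↔
        ∀ m ≤ N, HalfLine.rho β γ μ m * c m =
          f (HalfLine.R γ μ hβ m) + η * (HalfLine.R γ μ hβ m).1 0)) := by

  open HalfLine in
  refine ⟨⟨rfl, R_sub_lag_mem hβ⟩, A_R_R hβ hγ hμ, rho_pos hβ hγ hμ, span_R hβ, fun u hu => ?_,
    isDiscreteSolution_iff hβ hγ hμ η f, fun N c => ⟨fun m hm => A_sum_R hβ hγ hμ hm c,
      isDiscreteSolution_sum_iff hβ hγ hμ η f N c⟩⟩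
  -- Testing the weak equation with R_k turns the data into energy coefficients; the partial sums
  -- thus become projections of u.
  have hcoef : ∀ k, HalfLine.coef γ μ η hβ f k =
      HalfLine.A γ μ u (HalfLine.R γ μ hβ k) / HalfLine.rho β γ μ k := fun k => by
    rw [HalfLine.coef, hu]
  have hS : ∀ N, HalfLine.partialSum γ μ η hβ f N = HalfLine.truncation γ μ hβ u N := fun N => by
    simp only [HalfLine.partialSum, HalfLine.truncation, hcoef]
  have hA := HalfLine.tendsto_A_sub_truncation hβ hγ hμ u
  refine ⟨hcoef, ?_, fun x hx => ?_, fun hγ' => ?_⟩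
  · simpa only [hS] using hA
  · refine (HalfLine.tendsto_truncation_apply hβ hγ hμ u hx).congr fun N => ?_
    rw [← hS, HalfLine.partialSum, Submodule.coe_sum, Finset.sum_apply]
    rfl
  · simp only [hS]
    exact HalfLine.tendsto_h1norm (HalfLine.tendsto_norm_derivL2 hγ hμ hA)
      (HalfLine.tendsto_norm_toL2 hγ' hμ hA)
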